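/- Consider the $O(N)$ colored Grosse--Wulkenhaar model at $\Omega=1$ in the matrix basis, with mass parameter $\mu\in\mathbb{R}$, $A=2+\mu^2/4$, propagator $G_{mn}=(m_1+m_2+n_1+n_2+A)^{-1}$ for $m,n\in\mathbb{N}^2$ (diagonal in color, $C_{mn;kl}=G_{mn}\delta_{ml}\delta_{nk}$), and interaction $$V_1+V_2=\frac{\lambda_1}{2}\sum_{m,n,k,l}\phi^c_{mn}\phi^c_{nk}\phi^d_{kl}\phi^d_{lm}+\frac{\lambda_2}{4}\sum_{m,n,k,l}\phi^c_{mn}\phi^d_{nk}\phi^c_{kl}\phi^d_{lm},$$ with repeated colors summed from $1$ to $N$ and with matrix indices restricted to $\{0,\dots,\Lambda\}^2$ by an ultraviolet cutoff $\Lambda$. Each closed color loop gives a factor $N$, so that $N$ may be treated as a real parameter. Let $\Sigma(m,n)$ be the self-energy and let $\Gamma_{4,\parallel}(m,n,k,l)$, $\Gamma_{4,\times}(m,n,k,l)$ be the amputated one-particle irreducible four-point functions with external fields $\phi^a_{mn}\phi^a_{nk}\phi^b_{kl}\phi^b_{lm}$ and $\phi^a_{mn}\phi^b_{nk}\phi^a_{kl}\phi^b_{lm}$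 respectively (fixed external color threads $a$, $b$). They are formal power series in $(\lambda_1,\lambda_2)$, given by the sums over Wick contractions whose ribbon graphs are one-particle irreducible, of genus zero and with one broken external face. Put $Z=1-\partial_{m_1}\Sigma(m,n)|_{m=n=0}$ and $$\lambda_{1,r}=-\frac{\Gamma_{4,\parallel}(0,0,0,0)}{Z^2},\qquad \lambda_{2,r}=-\frac{\Gamma_{4,\times}(0,0,0,0)}{Z^2},\qquad S^{(1)}=\sum_{p\in\{0,\dots,\Lambda\}^2}\frac{1}{(p_1+p_2+A)^2}.$$ Then, for every $\Lambda$ and up to terms of total order at least three in $(\lambda_1,\lambda_2)$, $$\lambda_{1,r}=\lambda_1-\bigl(\lambda_1^2(1-N)+\lambda_2^2\bigr)S^{(1)},\qquad \lambda_{2,r}=\lambda_2+\bigl(2\lambda_2^2-2(1-N)\lambda_1\lambda_2\bigr)S^{(1)},$$ and $S^{(1)}$ diverges logarithmically when the cutoff is removed: $S^{(1)}\to\infty$ and $S^{(1)}=\log\Lambda+O(1)$ as $\Lambda\to\infty$. Consequently the one-loop $\beta$-coefficients, i.e. the coefficients of $-\lambda_1^2S^{(1)}$ in $\lambda_{1,r}$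 and of $-\lambda_2^2S^{(1)}$ in $\lambda_{2,r}$, are $\beta_\parallel=1-N$ and $\beta_\times=-2$. Let $\beta_i(\lambda)$ be the quadratic part of $-\lambda_{i,r}/S^{(1)}$, and let the one-loop flow of the bare couplings at fixed renormalized couplings be $d\lambda_i/ds=\beta_i(\lambda)$ in the scale $s=S^{(1)}$. On the line $\lambda_2=0$, with renormalized coupling $\lambda_1(s=0)=g>0$: if $N>1$ the model is asymptotically free (the bare coupling exists for all $s\ge 0$ and tends to $0$ as $s\to\infty$); if $N<1$ there is a Landau ghost (the bare coupling tends to $+\infty$ at a finite scale $s$); and the one-loop $\beta$-function vanishes on this line if and only if $N=1$. -/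

import Mathlib

open Filter Topology Asymptotics

noncomputable section

namespace ColorGW

/-! ### Propagator and cutoff -/

/-- Mass parameter `A = 2 + μ² / 4`. -/
def massA (μ : ℝ) : ℝ := 2 + μ ^ 2 / 4

/-- The propagator `G_{mn} = (m₁ + m₂ + n₁ + n₂ + A)⁻¹`, written for real index pairs, so that one can
differentiate with respect to an external index. -/
def propagator (μ : ℝ) (m n : ℝ × ℝ) : ℝ :=
  (m.1 + m.2 + n.1 + n.2 + massA μ)⁻¹

lemma propagator_comm (μ : ℝ) (m n : ℝ × ℝ) : propagator μ m n = propagator μ n m := by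
  unfold propagator
  congr 1
  ring

/-- With the ultraviolet cutoff `Λ`, matrix indices run over `{0, …, Λ}² ⊂ ℕ²`. -/
abbrev Box (Λ : ℕ) : Type := Fin (Λ + 1) × Fin (Λ + 1)

/-- The cut-off sum `S⁽¹⁾ = ∑_p 1 / (p + A)²`, with `p = p₁ + p₂` in the summand. -/
def S1 (μ : ℝ) (Λ : ℕ) : ℝ :=
  ∑ p : Box Λ, 1 / (((p.1 : ℕ) : ℝ) + ((p.2 : ℕ) : ℝ) + massA μ) ^ 2

/-! ### Wick contractions and ribbon graphs

A graph has `k` external fields `φ_{e₀e₁} φ_{e₁e₂} ⋯ φ_{e_{k-1}e₀}`, `n₁` parallel vertices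
`φ^c_{mn} φ^c_{nk} φ^d_{kl} φ^d_{lm}` and `n₂` crossed vertices `φ^c_{mn} φ^d_{nk} φ^c_{kl} φ^d_{lm}`. -/

/-- Vertices: `n₁` parallel ones (`Sum.inl`) and `n₂` crossed ones (`Sum.inr`). -/
abbrev Vertex (n₁ n₂ : ℕ) : Type := Fin n₁ ⊕ Fin n₂

/-- The fields: `k` external ones and four at each vertex. -/
abbrev Dart (k n₁ n₂ : ℕ) : Type := Fin k ⊕ (Vertex n₁ n₂ × Fin 4)

/-- The following field in the cyclic order of the trace in which a field stands. The field `d` is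
`φ_{x y}`, where `x` is the matrix index at `d` and `y` is the matrix index at `nextDart d`. -/
def nextDart (k n₁ n₂ : ℕ) : Equiv.Perm (Dart k n₁ n₂) :=
  Equiv.sumCongr (finRotate k) (Equiv.prodCongr (Equiv.refl _) (finRotate 4))

/-- Color pattern `a a b b` of four cyclically ordered fields. -/
def parallelMate : Equiv.Perm (Fin 4) := Equiv.swap 0 1 * Equiv.swap 2 3

/-- Color pattern `a b a b` of four cyclically ordered fields. -/
def crossedMate : Equiv.Perm (Fin 4) := Equiv.swap 0 2 * Equiv.swap 1 3

/-- The field at the same vertex that carries the same color (external fields are left alone). -/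
def colorMate {k n₁ n₂ : ℕ} : Dart k n₁ n₂ → Dart k n₁ n₂
  | Sum.inl i => Sum.inl i
  | Sum.inr (Sum.inl v, i) => Sum.inr (Sum.inl v, parallelMate i)
  | Sum.inr (Sum.inr v, i) => Sum.inr (Sum.inr v, crossedMate i)

section Graph

variable {k n₁ n₂ : ℕ} (σ : Equiv.Perm (Dart k n₁ n₂))

/-- `σ` pairs off all the fields, and every external field is paired with a field of a vertex. -/
def IsContraction : Prop :=
  (∀ d, σ (σ d) = d) ∧ (∀ d, σ d ≠ d) ∧ ∀ i : Fin k, ∃ h, σ (Sum.inl i) = Sum.inr h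

/-- The contraction of `φ_{mn}` with `φ_{kl}` is `G_{mn} δ_{ml} δ_{nk}`: the matrix index at `d` is
identified with the one at `nextDart (σ d)`. The orbits of this permutation are the faces. -/
def facePerm : Equiv.Perm (Dart k n₁ n₂) := σ.trans (nextDart k n₁ n₂)

/-- The number of faces (the product of external fields being counted as one more vertex). -/
def numFaces : ℕ := Nat.card (Quotient (Equiv.Perm.SameCycle.setoid (facePerm σ)))

/-- Two vertices joined by a propagator other than the one (if any) that contains a field of
`removed`. -/
def VertexAdj (removed : Set (Dart k n₁ n₂)) (v w : Vertex n₁ n₂) : Prop :=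
  ∃ i j : Fin 4, σ (Sum.inr (v, i)) = Sum.inr (w, j) ∧
    Sum.inr (v, i) ∉ removed ∧ Sum.inr (w, j) ∉ removed

/-- One-particle irreducible: connected, and still connected when any one internal propagator is
cut. (External propagators are amputated.) -/
def IsOnePI : Prop :=
  (∀ v w, Relation.ReflTransGen (VertexAdj σ ∅) v w) ∧
  ∀ h h' : Vertex n₁ n₂ × Fin 4, σ (Sum.inr h) = Sum.inr h' →
    ∀ v w, Relation.ReflTransGen (VertexAdj σ {Sum.inr h, Sum.inr h'}) v w

/-- Genus zero and a single broken face, along which the external fields stand in their cyclic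
order with pairwise independent matrix indices: with the product of external fields as an additional
vertex, the Euler characteristic `V - E + F` is `2`, and the external indices lie on distinct
faces. -/
def IsPlanarRegular : Prop :=
  2 * (n₁ + n₂ + 1) + 2 * numFaces σ = Fintype.card (Dart k n₁ n₂) + 4 ∧
  ∀ i j : Fin k, (facePerm σ).SameCycle (Sum.inl i) (Sum.inl j) → i = j

/-- Colors are transported along propagators and through vertices. -/
def colorSetoid : Setoid (Dart k n₁ n₂) :=
  Relation.EqvGen.setoid fun d d' => d' = σ d ∨ d' = colorMate d

/-- The color threads connect the external fields according to the given pattern. -/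
def ColorMatches (pattern : Equiv.Perm (Fin k)) : Prop :=
  ∀ i : Fin k, (colorSetoid σ).r (Sum.inl i) (Sum.inl (pattern i))

/-- The number of closed color loops, each of which yields a factor `N`. -/
def numColorLoops : ℕ :=
  Nat.card {q : Quotient (colorSetoid σ) // ∀ i : Fin k, q ≠ Quotient.mk _ (Sum.inl i)}

open Classical in
/-- The internal propagators. -/
def internalEdges : Finset (Sym2 (Dart k n₁ n₂)) :=
  (Finset.univ.filter fun d => d.isRight ∧ (σ d).isRight).image fun d => s(d, σ d)

/-- The value of a matrix index: the external index `e i`, or a summed index in the box. -/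
def indexValue {Λ : ℕ} (e : Fin k → ℝ × ℝ) : Fin k ⊕ Box Λ → ℝ × ℝ
  | Sum.inl i => e i
  | Sum.inr p => (((p.1 : ℕ) : ℝ), ((p.2 : ℕ) : ℝ))

open Classical in
/-- The assignments of matrix indices to the fields: constant on faces, equal to the external index
`i` on the face of the `i`-th external index, and a free index in the box on every other face. -/
def labelings (Λ : ℕ) : Finset (Dart k n₁ n₂ → Fin k ⊕ Box Λ) :=
  Finset.univ.filter fun x =>
    (∀ d, x (facePerm σ d) = x d) ∧ (∀ i : Fin k, x (Sum.inl i) = Sum.inl i) ∧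
    ∀ d, ∀ i : Fin k, x d = Sum.inl i → (facePerm σ).SameCycle d (Sum.inl i)

/-- The propagator of an edge `{d, d'}`; the index at `d'` is the second index of the field `d`. -/
def edgeValue (μ : ℝ) (y : Dart k n₁ n₂ → ℝ × ℝ) : Sym2 (Dart k n₁ n₂) → ℝ :=
  Sym2.lift ⟨fun d d' => propagator μ (y d) (y d'), fun _ _ => propagator_comm _ _ _⟩

/-- The amputated amplitude: the product of the internal propagators, summed over the indices of
the internal faces (no coupling constants, no color factor). -/
def amplitude (μ : ℝ) (Λ : ℕ) (e : Fin k → ℝ × ℝ) : ℝ :=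
  ∑ x ∈ labelings σ Λ, ∏ b ∈ internalEdges σ, edgeValue μ (fun d => indexValue e (x d)) b

end Graph

open Classical in
/-- The coefficient of `λ₁ ^ n₁ * λ₂ ^ n₂` in the amputated 1PI `k`-point function with the given
external color pattern: in the expansion of `exp (-V₁ - V₂)`, the sum over all Wick contractions
that give a planar regular 1PI graph, with the weights `-1/2` and `-1/4` of the vertices and a
factor `N` for each closed color loop. -/
def onePICoeff {k : ℕ} (pattern : Equiv.Perm (Fin k)) (μ N : ℝ) (Λ : ℕ) (e : Fin k → ℝ × ℝ)
    (n₁ n₂ : ℕ) : ℝ :=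
  ((-1 / 2 : ℝ) ^ n₁ / (n₁.factorial : ℝ)) * ((-1 / 4 : ℝ) ^ n₂ / (n₂.factorial : ℝ)) *
    ∑ σ ∈ Finset.univ.filter fun σ : Equiv.Perm (Dart k n₁ n₂) =>
        IsContraction σ ∧ IsOnePI σ ∧ IsPlanarRegular σ ∧ ColorMatches σ pattern,
      N ^ numColorLoops σ * amplitude σ μ Λ e

/-! ### Self-energy, wave function renormalization, renormalized couplings

Formal power series in `λ₁ = X 0` and `λ₂ = X 1`, at fixed cutoff. -/

/-- Coefficient of `λ₁ ^ n₁ * λ₂ ^ n₂` in the self-energy `Σ(m, n)`. -/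
def selfEnergyCoeff (μ N : ℝ) (Λ : ℕ) (m n : ℝ × ℝ) (n₁ n₂ : ℕ) : ℝ :=
  onePICoeff (Equiv.swap (0 : Fin 2) 1) μ N Λ ![m, n] n₁ n₂

/-- `∂Σ(m, n)/∂m₁` at `m = n = 0`. (Each coefficient of `Σ` is a rational function of `m₁` without
pole at `0`.) -/
def dSelfEnergy (μ N : ℝ) (Λ : ℕ) : MvPowerSeries (Fin 2) ℝ :=
  fun d => deriv (fun t : ℝ => selfEnergyCoeff μ N Λ (t, 0) (0, 0) (d 0) (d 1)) 0

/-- The wave function renormalization `Z = 1 - ∂Σ(m, n)/∂m₁` at `m = n = 0`. -/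
def waveZ (μ N : ℝ) (Λ : ℕ) : MvPowerSeries (Fin 2) ℝ := 1 - dSelfEnergy μ N Λ

/-- The amputated 1PI four-point function at vanishing external indices, for the external color
pattern `a a b b` (`i = 0`) or `a b a b` (`i = 1`). -/
def gammaFour (μ N : ℝ) (Λ : ℕ) (i : Fin 2) : MvPowerSeries (Fin 2) ℝ :=
  fun d => onePICoeff (![parallelMate, crossedMate] i) μ N Λ (fun _ => (0, 0)) (d 0) (d 1)

/-- The renormalized couplings `λ_{1,r}` (`i = 0`) and `λ_{2,r}` (`i = 1`):
`-Γ₄(0,0,0,0) / Z²`. The constant coefficient of `Z` is `1`. -/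
def lambdaR (μ N : ℝ) (Λ : ℕ) (i : Fin 2) : MvPowerSeries (Fin 2) ℝ :=
  -gammaFour μ N Λ i * (waveZ μ N Λ ^ 2)⁻¹

/-- Equality up to terms of total order at least three in the couplings. -/
def EqModCubic (f g : MvPowerSeries (Fin 2) ℝ) : Prop :=
  ∀ d : Fin 2 →₀ ℕ, d 0 + d 1 ≤ 2 → MvPowerSeries.coeff d f = MvPowerSeries.coeff d g

/-! ### One-loop β-functions and flow -/

/-- The coefficient of `λ₁ ^ a * λ₂ ^ b` in `-λ_{i,r} / S⁽¹⁾`. -/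
def flowCoeff (μ N : ℝ) (Λ : ℕ) (i : Fin 2) (a b : ℕ) : ℝ :=
  -MvPowerSeries.coeff (Finsupp.single 0 a + Finsupp.single 1 b) (lambdaR μ N Λ i) / S1 μ Λ

/-- `β_∥`: the coefficient of `-λ₁² S⁽¹⁾` in `λ_{1,r}`. -/
def betaParallel (μ N : ℝ) (Λ : ℕ) : ℝ := flowCoeff μ N Λ 0 2 0

/-- `β_×`: the coefficient of `-λ₂² S⁽¹⁾` in `λ_{2,r}`. -/
def betaCrossed (μ N : ℝ) (Λ : ℕ) : ℝ := flowCoeff μ N Λ 1 0 2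

/-- The one-loop β-function: `λ_{i,r} = λ_i - β_i(λ) S⁽¹⁾` up to third order. -/
def betaFunction (μ N : ℝ) (Λ : ℕ) (x : Fin 2 → ℝ) : Fin 2 → ℝ := fun i =>
  flowCoeff μ N Λ i 2 0 * x 0 ^ 2 + flowCoeff μ N Λ i 1 1 * (x 0 * x 1) +
    flowCoeff μ N Λ i 0 2 * x 1 ^ 2

/-- `x s` is the bare parallel coupling when `S⁽¹⁾ = s`, for the fixed renormalized coupling `g` and
vanishing crossed coupling: `(x, 0)` solves the one-loop flow equation `dλ/ds = β(λ)` on `I`. -/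
def IsParallelFlow (β : (Fin 2 → ℝ) → Fin 2 → ℝ) (g : ℝ) (I : Set ℝ) (x : ℝ → ℝ) : Prop :=
  x 0 = g ∧ ∀ s ∈ I, HasDerivWithinAt (fun t => ![x t, 0]) (β ![x s, 0]) I s

/-- Asymptotic freedom at `λ₂ = 0`: at fixed renormalized coupling, the bare coupling exists at all
scales and tends to zero when the cutoff is removed. -/
def AsymptoticallyFree (β : (Fin 2 → ℝ) → Fin 2 → ℝ) : Prop :=
  ∀ g : ℝ, 0 < g → (∃ x, IsParallelFlow β g (Set.Ici 0) x) ∧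
    ∀ x, IsParallelFlow β g (Set.Ici 0) x → Tendsto x atTop (𝓝 0)

/-- Landau ghost at `λ₂ = 0`: at fixed renormalized coupling, the bare coupling grows beyond all
bounds, already at a finite scale. -/
def HasLandauGhost (β : (Fin 2 → ℝ) → Fin 2 → ℝ) : Prop :=
  ∀ g : ℝ, 0 < g → ∃ T : ℝ, 0 < T ∧ (∃ x, IsParallelFlow β g (Set.Ico 0 T) x) ∧
    ∀ x, IsParallelFlow β g (Set.Ico 0 T) x → Tendsto x (𝓝[<] T) atTop

end ColorGW

end

/-! To second order the statement is a finite count of Wick contractions, followed by elementary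
analysis.

Colors are ignored at first. Euler's formula leaves no inner face (one without external index) in a
planar regular four-point graph with one vertex, and exactly one inner face in a two-point graph
with one vertex or a four-point graph with two. Following the faces, and using that external indices
lie on distinct faces, shows that every admissible contraction is a relabeling of `star`, `tadpole`
or `bubble` (`exists_eq_relabel_star`, `exists_eq_relabel_tadpole`, `exists_eq_relabel_bubble`). The
relabelings form injective families with 4, 8 and 64 members, so each coefficient becomes a sum over
them (`onePICoeff_eq_sum`).

Colors then enter through the rotations: turning a parallel vertex by one step exchanges the
pairings `01|23` and `03|12`, while a crossed vertex always pairs `02|13`. Which external fields are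
joined, and whether a loop closes, is thus a finite check on the three models. With `S` for the
cut-off sum the count gives, at vanishing external indices and up to higher orders, `Γ∥ = -λ₁ + ((N
+ 3) λ₁² + 2 λ₁ λ₂ + λ₂²) S`, `Γ× = -λ₂ + 4 λ₁ λ₂ S`, `Z = 1 - ((N + 1) λ₁ + λ₂) S`. The same `S`
occurs throughout because differentiating the tadpole squares its propagator. Expanding `-Γ / Z²`
(`mul_inv_sq_sub_mem`) yields the renormalized couplings.

Comparing the inner sums of `S` with telescoping ones brackets it between logarithms. On the line
`λ₂ = 0` the flow is `x' = (1 - N) x²`, solved by `g / (1 - (1 - N) g s)`; the sign of `1 - N`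
decides between decay and blow-up. -/

noncomputable section

namespace ColorGW

/-! ### Invariance of the graph data under relabeling -/

section Relabel

variable {k n₁ n₂ m₁ m₂ : ℕ}

/-- Cyclic shift of the external fields, together with a bijection of the vertices and a rotation
of each of them. -/
def relabel (s : Fin (k + 1)) (φ : Vertex n₁ n₂ ≃ Vertex m₁ m₂) (ρ : Vertex n₁ n₂ → Fin 4) :
    Dart (k + 1) n₁ n₂ ≃ Dart (k + 1) m₁ m₂ :=
  Equiv.sumCongr (Equiv.addRight s) (Equiv.prodShear φ fun v => Equiv.addRight (ρ v))

variable (s : Fin (k + 1)) (φ : Vertex n₁ n₂ ≃ Vertex m₁ m₂) (ρ : Vertex n₁ n₂ → Fin 4)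

@[simp] lemma relabel_inl (i : Fin (k + 1)) : relabel s φ ρ (Sum.inl i) = Sum.inl (i + s) := rfl

@[simp] lemma relabel_inr (v : Vertex n₁ n₂) (a : Fin 4) :
    relabel s φ ρ (Sum.inr (v, a)) = Sum.inr (φ v, a + ρ v) := rfl

@[simp] lemma relabel_symm_inl (i : Fin (k + 1)) :
    (relabel s φ ρ).symm (Sum.inl i) = Sum.inl (i - s) := by
  rw [Equiv.symm_apply_eq]; simp

@[simp] lemma nextDart_inl (i : Fin (k + 1)) :
    nextDart (k + 1) n₁ n₂ (Sum.inl i) = Sum.inl (i + 1) := by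
  simp [nextDart]

@[simp] lemma nextDart_inr (v : Vertex n₁ n₂) (a : Fin 4) :
    nextDart k n₁ n₂ (Sum.inr (v, a)) = Sum.inr (v, a + 1) := by
  simp [nextDart]

lemma relabel_nextDart (d : Dart (k + 1) n₁ n₂) :
    relabel s φ ρ (nextDart _ _ _ d) = nextDart _ _ _ (relabel s φ ρ d) := by
  rcases d with i | ⟨v, a⟩
  · simp [add_right_comm]
  · simp [add_right_comm]

lemma relabel_isRight (d : Dart (k + 1) n₁ n₂) : (relabel s φ ρ d).isRight = d.isRight := by
  rcases d with i | ⟨v, a⟩ <;> rfl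

variable (σ : Equiv.Perm (Dart (k + 1) n₁ n₂))

lemma permCongr_apply_relabel (d : Dart (k + 1) n₁ n₂) :
    (relabel s φ ρ).permCongr σ (relabel s φ ρ d) = relabel s φ ρ (σ d) := by
  simp [Equiv.permCongr_apply]

lemma facePerm_apply (d : Dart k n₁ n₂) (σ : Equiv.Perm (Dart k n₁ n₂)) :
    facePerm σ d = nextDart _ _ _ (σ d) := rfl

/-- Shifts and rotations respect the cyclic order of every trace, so conjugating the contraction
conjugates the face permutation. The face count and the separation of the external indices are then
invariant. -/
lemma facePerm_permCongr_relabel :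
    facePerm ((relabel s φ ρ).permCongr σ) = (relabel s φ ρ).permCongr (facePerm σ) := by
  ext1 d
  obtain ⟨d, rfl⟩ := (relabel s φ ρ).surjective d
  rw [facePerm_apply, permCongr_apply_relabel, permCongr_apply_relabel, facePerm_apply,
    relabel_nextDart]

lemma sameCycle_permCongr {α β : Type*} (e : α ≃ β) (f : Equiv.Perm α) (x y : α) :
    (e.permCongr f).SameCycle (e x) (e y) ↔ f.SameCycle x y := by
  have h (n : ℤ) : (e.permCongr f) ^ n = e.permCongr (f ^ n) :=
    (map_zpow e.permCongrHom f n).symm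
  simp only [Equiv.Perm.SameCycle, h, Equiv.permCongr_apply, Equiv.symm_apply_apply,
    EmbeddingLike.apply_eq_iff_eq]

lemma sameCycle_facePerm_relabel (d d' : Dart (k + 1) n₁ n₂) :
    (facePerm ((relabel s φ ρ).permCongr σ)).SameCycle (relabel s φ ρ d) (relabel s φ ρ d') ↔
      (facePerm σ).SameCycle d d' := by
  rw [facePerm_permCongr_relabel, sameCycle_permCongr]

lemma numFaces_relabel : numFaces ((relabel s φ ρ).permCongr σ) = numFaces σ := by
  refine Nat.card_congr (Quotient.congr (relabel s φ ρ) fun d d' => ?_).symm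
  exact (sameCycle_facePerm_relabel s φ ρ σ d d').symm

lemma isContraction_relabel (h : IsContraction σ) :
    IsContraction ((relabel s φ ρ).permCongr σ) := by
  obtain ⟨h1, h2, h3⟩ := h
  refine ⟨fun d => ?_, fun d => ?_, fun i => ?_⟩
  · obtain ⟨d, rfl⟩ := (relabel s φ ρ).surjective d
    simp only [permCongr_apply_relabel, h1]
  · obtain ⟨d, rfl⟩ := (relabel s φ ρ).surjective d
    simpa only [permCongr_apply_relabel, ne_eq, EmbeddingLike.apply_eq_iff_eq] using h2 d
  · obtain ⟨⟨v, a⟩, h⟩ := h3 (i - s)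
    refine ⟨(φ v, a + ρ v), ?_⟩
    have := permCongr_apply_relabel s φ ρ σ (Sum.inl (i - s))
    rw [h] at this
    simpa using this

lemma vertexAdj_relabel {R : Set (Dart (k + 1) n₁ n₂)} {v w : Vertex n₁ n₂}
    (h : VertexAdj σ R v w) :
    VertexAdj ((relabel s φ ρ).permCongr σ) (relabel s φ ρ '' R) (φ v) (φ w) := by
  obtain ⟨i, j, h1, h2, h3⟩ := h
  refine ⟨i + ρ v, j + ρ w, ?_, ?_, ?_⟩
  · rw [← relabel_inr s, permCongr_apply_relabel, h1, relabel_inr]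
  · rwa [← relabel_inr s, (relabel s φ ρ).injective.mem_set_image]
  · rwa [← relabel_inr s, (relabel s φ ρ).injective.mem_set_image]

lemma isOnePI_relabel (h : IsOnePI σ) : IsOnePI ((relabel s φ ρ).permCongr σ) := by
  obtain ⟨h1, h2⟩ := h
  refine ⟨fun v w => ?_, fun x x' hx v w => ?_⟩
  · obtain ⟨v, rfl⟩ := φ.surjective v
    obtain ⟨w, rfl⟩ := φ.surjective w
    refine (h1 v w).lift φ fun a b hab => ?_
    simpa using vertexAdj_relabel s φ ρ σ hab
  · obtain ⟨v, rfl⟩ := φ.surjective v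
    obtain ⟨w, rfl⟩ := φ.surjective w
    have key (y : Vertex m₁ m₂ × Fin 4) : ∃ z : Vertex n₁ n₂ × Fin 4,
        (Sum.inr y : Dart (k + 1) m₁ m₂) = relabel s φ ρ (Sum.inr z) :=
      ⟨(φ.symm y.1, y.2 - ρ (φ.symm y.1)), by simp⟩
    obtain ⟨z, hz⟩ := key x
    obtain ⟨z', hz'⟩ := key x'
    rw [hz, hz', permCongr_apply_relabel, EmbeddingLike.apply_eq_iff_eq] at hx
    refine (h2 z z' hx v w).lift φ fun a b hab => ?_
    simpa [hz, hz', Set.image_pair] using vertexAdj_relabel s φ ρ σ hab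

/-- `φ` may turn parallel vertices into crossed ones: the Euler count sees only the total number of
vertices. -/
lemma isPlanarRegular_relabel (hn : n₁ + n₂ = m₁ + m₂) (h : IsPlanarRegular σ) :
    IsPlanarRegular ((relabel s φ ρ).permCongr σ) := by
  obtain ⟨h1, h2⟩ := h
  refine ⟨?_, fun i j hij => ?_⟩
  · rw [numFaces_relabel, ← hn, h1, Fintype.card_congr (relabel s φ ρ)]
  · have := (sameCycle_facePerm_relabel s φ ρ σ (Sum.inl (i - s)) (Sum.inl (j - s))).1
      (by simpa using hij)
    simpa using h2 _ _ this

/-! ### Amplitudes -/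

lemma mem_labelings {σ : Equiv.Perm (Dart k n₁ n₂)} {Λ : ℕ} {x : Dart k n₁ n₂ → Fin k ⊕ Box Λ} :
    x ∈ labelings σ Λ ↔ (∀ d, x (facePerm σ d) = x d) ∧ (∀ i : Fin k, x (Sum.inl i) = Sum.inl i) ∧
    ∀ d, ∀ i : Fin k, x d = Sum.inl i → (facePerm σ).SameCycle d (Sum.inl i) := by
  classical
  simp [labelings]

lemma apply_eq_of_sameCycle {α β : Type*} {f : Equiv.Perm α} {x : α → β}
    (h : ∀ d, x (f d) = x d) {d d' : α} (hd : f.SameCycle d d') : x d = x d' := by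
  obtain ⟨n, rfl⟩ := hd
  induction n with
  | zero => simp
  | succ n ih => rw [add_comm, zpow_add, zpow_one, Equiv.Perm.mul_apply, h, ih]
  | pred n ih =>
    rw [ih, ← h ((f ^ (-(n : ℤ) - 1)) d), ← Equiv.Perm.mul_apply, ← zpow_one_add,
      add_sub_cancel]

/-- If the faces are the fibres of a map to the external indices and a set `ι` of internal faces,
the labelings are the assignments of a box element to each internal face. -/
lemma amplitude_eq_sum {ι : Type*} [Fintype ι] [DecidableEq ι] {σ : Equiv.Perm (Dart k n₁ n₂)}
    (F : Dart k n₁ n₂ → Fin k ⊕ ι) (hF : ∀ d d', (facePerm σ).SameCycle d d' ↔ F d = F d')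
    (hext : ∀ i, F (Sum.inl i) = Sum.inl i) (hsurj : Function.Surjective F)
    (μ : ℝ) (Λ : ℕ) (e : Fin k → ℝ × ℝ) :
    amplitude σ μ Λ e = ∑ p : ι → Box Λ, ∏ b ∈ internalEdges σ,
      edgeValue μ (fun d => indexValue e (Sum.map id p (F d))) b := by
  classical
  have hval : ∀ i : Fin k ⊕ ι, ∃ d, F d = i := hsurj
  choose r hr using hval
  have hlab (x) (hx : x ∈ labelings σ Λ) : ∃ p : ι → Box Λ, ∀ d, x d = Sum.map id p (F d) := by
    obtain ⟨h1, h2, h3⟩ := mem_labelings.1 hx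
    have hp (a : ι) : ∃ p, x (r (Sum.inr a)) = Sum.inr p := by
      rcases hxa : x (r (Sum.inr a)) with i | p
      · have := (hF _ _).1 (h3 _ _ hxa)
        rw [hr, hext] at this
        cases this
      · exact ⟨p, rfl⟩
    choose p hp using hp
    refine ⟨p, fun d => ?_⟩
    rcases hd : F d with i | a
    · rw [apply_eq_of_sameCycle h1 ((hF d (Sum.inl i)).2 (by rw [hd, hext])), h2]
      rfl
    · rw [apply_eq_of_sameCycle h1 ((hF d (r (Sum.inr a))).2 (by rw [hd, hr])), hp]
      rfl
  unfold amplitude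
  symm
  refine Finset.sum_bij (fun p _ d => Sum.map id p (F d)) (fun p _ => ?_) (fun p _ q _ h => ?_)
    (fun x hx => ?_) fun p _ => rfl
  · refine mem_labelings.2 ⟨fun d => ?_, fun i => by rw [hext]; rfl, fun d i hd => ?_⟩
    · rw [(hF (facePerm σ d) d).1 (Equiv.Perm.sameCycle_apply_left.2 (.refl _ _))]
    · rw [hF, hext]
      rcases hFd : F d with j | a
      · rw [hFd] at hd
        simpa using hd
      · rw [hFd] at hd
        simp at hd
  · funext a
    have := congrFun h (r (Sum.inr a))
    simpa [hr] using this
  · obtain ⟨p, hp⟩ := hlab x hx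
    exact ⟨p, Finset.mem_univ _, (funext hp).symm⟩

lemma internalEdges_relabel [DecidableEq (Sym2 (Dart (k + 1) m₁ m₂))] :
    internalEdges ((relabel s φ ρ).permCongr σ) =
      (internalEdges σ).image (Sym2.map (relabel s φ ρ)) := by
  classical
  ext b
  simp only [internalEdges, Finset.mem_image, Finset.mem_filter, Finset.mem_univ, true_and]
  constructor
  · rintro ⟨d, ⟨h1, h2⟩, rfl⟩
    obtain ⟨d, rfl⟩ := (relabel s φ ρ).surjective d
    rw [permCongr_apply_relabel, relabel_isRight] at h2
    rw [relabel_isRight] at h1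
    refine ⟨_, ⟨d, ⟨h1, h2⟩, rfl⟩, ?_⟩
    rw [permCongr_apply_relabel, Sym2.map_mk]
  · rintro ⟨_, ⟨d, ⟨h1, h2⟩, rfl⟩, rfl⟩
    refine ⟨relabel s φ ρ d, ⟨by rwa [relabel_isRight], ?_⟩, ?_⟩
    · rwa [permCongr_apply_relabel, relabel_isRight]
    · rw [permCongr_apply_relabel, Sym2.map_mk]

/-- Only the shift `s` is felt, through the external indices. A labeling is transported along the
relabeling, with its external values shifted by `s` as well. -/
lemma amplitude_relabel (μ : ℝ) (Λ : ℕ) (e : Fin (k + 1) → ℝ × ℝ) :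
    amplitude ((relabel s φ ρ).permCongr σ) μ Λ e = amplitude σ μ Λ fun i => e (i + s) := by
  classical
  unfold amplitude
  symm
  set Φ := relabel s φ ρ with hΦ
  refine Finset.sum_bij (fun x _ d => Sum.map (· + s) id (x (Φ.symm d))) (fun x hx => ?_)
    (fun x _ y _ h => ?_) (fun y hy => ?_) fun x hx => ?_
  · obtain ⟨h1, h2, h3⟩ := mem_labelings.1 hx
    refine mem_labelings.2 ⟨fun d => ?_, fun i => ?_, fun d i hd => ?_⟩
    · obtain ⟨d, rfl⟩ := Φ.surjective d
      rw [hΦ, facePerm_permCongr_relabel, permCongr_apply_relabel]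
      simp [h1]
    · simp [hΦ, h2]
    · obtain ⟨d, rfl⟩ := Φ.surjective d
      have hd' : x d = Sum.inl (i - s) := by
        simp only [Equiv.symm_apply_apply] at hd
        rcases hxd : x d with j | p
        · rw [hxd] at hd
          simp only [Sum.map_inl, Sum.inl.injEq] at hd
          rw [← hd]; simp
        · rw [hxd] at hd
          simp at hd
      have := (sameCycle_facePerm_relabel s φ ρ σ _ _).2 (h3 _ _ hd')
      simpa using this
  · funext d
    have := congrFun h (Φ d)
    simp only [Equiv.symm_apply_apply] at this
    exact Function.Injective.sumMap (add_left_injective s) Function.injective_id this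
  · obtain ⟨h1, h2, h3⟩ := mem_labelings.1 hy
    refine ⟨fun d => Sum.map (· - s) id (y (Φ d)), ?_, ?_⟩
    · refine mem_labelings.2 ⟨fun d => ?_, fun i => ?_, fun d i hd => ?_⟩
      · have := h1 (Φ d)
        rw [hΦ, facePerm_permCongr_relabel, permCongr_apply_relabel] at this
        rw [hΦ, this]
      · simp [hΦ, h2]
      · have hd' : y (Φ d) = Sum.inl (i + s) := by
          rcases hxd : y (Φ d) with j | p
          · rw [hxd] at hd
            simp only [Sum.map_inl, Sum.inl.injEq] at hd
            rw [← hd]; simp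
          · rw [hxd] at hd
            simp at hd
        exact (sameCycle_facePerm_relabel s φ ρ σ _ _).1 (by simpa [hΦ] using h3 _ _ hd')
    · funext d
      simp only [Equiv.apply_symm_apply]
      rcases y d with j | p <;> simp
  · rw [hΦ, internalEdges_relabel, Finset.prod_image (Sym2.map.injective Φ.injective).injOn]
    refine Finset.prod_congr rfl fun b _ => ?_
    induction b with
    | _ d d' =>
      have h (z : Fin (k + 1) ⊕ Box Λ) : indexValue e (Sum.map (· + s) id z) =
          indexValue (fun i => e (i + s)) z := by
        rcases z with j | p <;> rfl
      simp [edgeValue, ← hΦ, h]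

end Relabel

/-! ### Faces of a contraction and the three model graphs -/

section Classification

variable {k n₁ n₂ : ℕ}

/-! ### Faces -/

lemma numFaces_eq_card {ι : Type*} [Fintype ι] {σ : Equiv.Perm (Dart k n₁ n₂)}
    (F : Dart k n₁ n₂ → Fin k ⊕ ι) (hF : ∀ d d', (facePerm σ).SameCycle d d' ↔ F d = F d')
    (hsurj : Function.Surjective F) : numFaces σ = k + Fintype.card ι := by
  have h : Function.Bijective (Quotient.lift (s := Equiv.Perm.SameCycle.setoid (facePerm σ)) F
      fun a b hab => (hF a b).1 hab) := by
    constructor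
    · rintro ⟨a⟩ ⟨b⟩ hab
      exact Quotient.sound ((hF a b).2 hab)
    · intro y
      obtain ⟨d, rfl⟩ := hsurj y
      exact ⟨Quotient.mk _ d, rfl⟩
  unfold numFaces
  rw [Nat.card_congr (Equiv.ofBijective _ h)]
  simp

/-- This turns a statement about all integer powers into a finite check: a labeling constant on
orbits, and a representative of each label from which the whole fibre is reached. Faces of the model
graphs have at most three fields, so fewer than four iterations suffice. -/
lemma sameCycle_iff_of_iterate {α β : Type*} {f : Equiv.Perm α} (F : α → β) (r : β → α)
    (hF : ∀ d, F (f d) = F d) (hr : ∀ d, ∃ j < 4, f^[j] (r (F d)) = d) (d d' : α) :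
    f.SameCycle d d' ↔ F d = F d' := by
  have key (d : α) : f.SameCycle (r (F d)) d := by
    obtain ⟨j, -, hj⟩ := hr d
    refine ⟨j, ?_⟩
    rw [zpow_natCast, ← Equiv.Perm.iterate_eq_pow, hj]
  refine ⟨apply_eq_of_sameCycle hF, fun h => (key d).symm.trans ?_⟩
  rw [h]
  exact key d'

lemma exists_inner_face {σ : Equiv.Perm (Dart k n₁ n₂)} (h : k < numFaces σ) :
    ∃ x, ∀ i, ¬ (facePerm σ).SameCycle x (Sum.inl i) := by
  by_contra! hcon
  have : Function.Surjective fun i : Fin k =>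
      (Quotient.mk (Equiv.Perm.SameCycle.setoid (facePerm σ)) (Sum.inl i)) := by
    rintro ⟨x⟩
    obtain ⟨i, hi⟩ := hcon x
    exact ⟨i, Quotient.sound hi.symm⟩
  have := Nat.card_le_card_of_surjective _ this
  simp only [Nat.card_eq_fintype_card, Fintype.card_fin] at this
  exact absurd h (not_lt.2 this)

section Faces

variable {σ : Equiv.Perm (Dart (k + 1) n₁ n₂)}

lemma facePerm_of_eq_inl {d : Dart (k + 1) n₁ n₂} {j : Fin (k + 1)} (h : σ d = Sum.inl j) :
    facePerm σ d = Sum.inl (j + 1) := by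
  rw [facePerm_apply, h, nextDart_inl]

lemma facePerm_of_eq_inr {d : Dart (k + 1) n₁ n₂} {v : Vertex n₁ n₂} {a : Fin 4}
    (h : σ d = Sum.inr (v, a)) : facePerm σ d = Sum.inr (v, a + 1) := by
  rw [facePerm_apply, h, nextDart_inr]

/-- After a field contracted with external field `j` the face continues at external field `j + 1`.
Since a face carries only one external index, this must be the `i` it came from. This fixes the
order of the external legs. -/
lemma add_one_eq_of_sameCycle (hp : IsPlanarRegular σ) {d : Dart (k + 1) n₁ n₂}
    {i j : Fin (k + 1)} (hd : (facePerm σ).SameCycle (Sum.inl i) d) (h : σ d = Sum.inl j) :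
    j + 1 = i := by
  refine (hp.2 _ _ (hd.trans ?_)).symm
  rw [← facePerm_of_eq_inl h, Equiv.Perm.sameCycle_apply_right]

lemma not_eq_inl_of_inner {x : Dart (k + 1) n₁ n₂}
    (hx : ∀ i, ¬ (facePerm σ).SameCycle x (Sum.inl i)) (j : Fin (k + 1)) : σ x ≠ Sum.inl j := by
  intro h
  refine hx (j + 1) ?_
  rw [← facePerm_of_eq_inl h, Equiv.Perm.sameCycle_apply_right]

lemma inner_facePerm {x : Dart (k + 1) n₁ n₂}
    (hx : ∀ i, ¬ (facePerm σ).SameCycle x (Sum.inl i)) (i : Fin (k + 1)) :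
    ¬ (facePerm σ).SameCycle (facePerm σ x) (Sum.inl i) := by
  rw [Equiv.Perm.sameCycle_apply_left]
  exact hx i

lemma exists_inr_of_inner {x : Dart (k + 1) n₁ n₂}
    (hx : ∀ i, ¬ (facePerm σ).SameCycle x (Sum.inl i)) : ∃ v a, x = Sum.inr (v, a) := by
  rcases x with i | ⟨v, a⟩
  · exact absurd (.refl _ _) (hx i)
  · exact ⟨v, a, rfl⟩

lemma eq_permCongr_relabel {m₁ m₂ : ℕ} {s : Fin (k + 1)} {φ : Vertex m₁ m₂ ≃ Vertex n₁ n₂}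
    {ρ : Vertex m₁ m₂ → Fin 4} {τ : Equiv.Perm (Dart (k + 1) m₁ m₂)}
    (h : ∀ d, σ (relabel s φ ρ d) = relabel s φ ρ (τ d)) : σ = (relabel s φ ρ).permCongr τ := by
  ext1 d
  obtain ⟨d, rfl⟩ := (relabel s φ ρ).surjective d
  rw [h, permCongr_apply_relabel]

/-- The fields contracted with external fields exhaust the complement of a set of the right size. -/
lemma exists_inl_of_notMem (hc : IsContraction σ) (S : Finset (Vertex n₁ n₂ × Fin 4))
    (hS : ∀ x ∈ S, ∃ y, σ (Sum.inr x) = Sum.inr y) (hcard : 4 * (n₁ + n₂) = S.card + (k + 1))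
    {x : Vertex n₁ n₂ × Fin 4} (hx : x ∉ S) : ∃ j, σ (Sum.inr x) = Sum.inl j := by
  classical
  obtain ⟨h1, -, h3⟩ := hc
  choose g hg using h3
  have hinj : Function.Injective g := fun i j hij => by
    have : σ (Sum.inl i) = σ (Sum.inl j) := by rw [hg, hg, hij]
    simpa using this
  have hsub : Finset.univ.image g ⊆ Sᶜ := by
    intro y hy
    obtain ⟨i, -, rfl⟩ := Finset.mem_image.1 hy
    rw [Finset.mem_compl]
    intro hi
    obtain ⟨y, hy⟩ := hS _ hi
    rw [← hg, h1] at hy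
    cases hy
  have heq := Finset.eq_of_subset_of_card_le hsub (by
    rw [Finset.card_compl, Finset.card_image_of_injective _ hinj]
    simp only [Fintype.card_prod, Fintype.card_sum, Fintype.card_fin, Finset.card_univ]
    omega)
  have : x ∈ Finset.univ.image g := by rw [heq]; simpa using hx
  obtain ⟨i, -, rfl⟩ := Finset.mem_image.1 this
  exact ⟨i, by rw [← hg, h1]⟩

end Faces

/-! ### The planar regular graphs of the lowest orders -/

/-- The conditions on a contraction that do not refer to colors. -/
def IsAdmissible (σ : Equiv.Perm (Dart k n₁ n₂)) : Prop :=
  IsContraction σ ∧ IsOnePI σ ∧ IsPlanarRegular σ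

lemma IsAdmissible.relabel {m₁ m₂ : ℕ} {σ : Equiv.Perm (Dart (k + 1) n₁ n₂)} (h : IsAdmissible σ)
    (s : Fin (k + 1)) (φ : Vertex n₁ n₂ ≃ Vertex m₁ m₂) (ρ : Vertex n₁ n₂ → Fin 4) :
    IsAdmissible ((relabel s φ ρ).permCongr σ) := by
  refine ⟨isContraction_relabel _ _ _ _ h.1, isOnePI_relabel _ _ _ _ h.2.1,
    isPlanarRegular_relabel _ _ _ _ ?_ h.2.2⟩
  simpa using Fintype.card_congr φ

lemma isOnePI_of_subsingleton (h : ∀ v w : Vertex n₁ n₂, v = w)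
    (σ : Equiv.Perm (Dart k n₁ n₂)) : IsOnePI σ :=
  ⟨fun v w => h v w ▸ .refl, fun _ _ _ v w => h v w ▸ .refl⟩

/-- The four external fields contracted with a single vertex. -/
def star : Equiv.Perm (Dart 4 1 0) :=
  Function.Involutive.toPerm
    (fun
      | Sum.inl i => Sum.inr (Sum.inl 0, -i)
      | Sum.inr (Sum.inl _, a) => Sum.inl (-a)
      | Sum.inr (Sum.inr v, _) => v.elim0) (by unfold Function.Involutive; decide)

/-- A vertex two neighboring fields of which are contracted with each other. -/
def tadpole : Equiv.Perm (Dart 2 1 0) :=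
  Function.Involutive.toPerm
    (fun
      | Sum.inl 0 => Sum.inr (Sum.inl 0, 2)
      | Sum.inl 1 => Sum.inr (Sum.inl 0, 1)
      | Sum.inr (Sum.inl _, 0) => Sum.inr (Sum.inl 0, 3)
      | Sum.inr (Sum.inl _, 1) => Sum.inl 1
      | Sum.inr (Sum.inl _, 2) => Sum.inl 0
      | Sum.inr (Sum.inl _, 3) => Sum.inr (Sum.inl 0, 0)
      | Sum.inr (Sum.inr v, _) => v.elim0) (by unfold Function.Involutive; decide)

/-- Two vertices joined by two propagators. -/
def bubble : Equiv.Perm (Dart 4 2 0) :=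
  Function.Involutive.toPerm
    (fun
      | Sum.inl 0 => Sum.inr (Sum.inl 0, 0)
      | Sum.inl 1 => Sum.inr (Sum.inl 0, 3)
      | Sum.inl 2 => Sum.inr (Sum.inl 1, 0)
      | Sum.inl 3 => Sum.inr (Sum.inl 1, 3)
      | Sum.inr (Sum.inl 0, 0) => Sum.inl 0
      | Sum.inr (Sum.inl 0, 1) => Sum.inr (Sum.inl 1, 2)
      | Sum.inr (Sum.inl 0, 2) => Sum.inr (Sum.inl 1, 1)
      | Sum.inr (Sum.inl 0, 3) => Sum.inl 1
      | Sum.inr (Sum.inl 1, 0) => Sum.inl 2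
      | Sum.inr (Sum.inl 1, 1) => Sum.inr (Sum.inl 0, 2)
      | Sum.inr (Sum.inl 1, 2) => Sum.inr (Sum.inl 0, 1)
      | Sum.inr (Sum.inl 1, 3) => Sum.inl 3
      | Sum.inr (Sum.inr v, _) => v.elim0) (by unfold Function.Involutive; decide)

/-- The face of a field of `star`. -/
def starFace : Dart 4 1 0 → Fin 4 ⊕ Fin 0
  | Sum.inl i => Sum.inl i
  | Sum.inr (_, a) => Sum.inl (1 - a)

/-- The face of a field of `tadpole`. -/
def tadpoleFace : Dart 2 1 0 → Fin 2 ⊕ Fin 1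
  | Sum.inl i => Sum.inl i
  | Sum.inr (_, a) => ![Sum.inr 0, Sum.inl 0, Sum.inl 1, Sum.inl 0] a

/-- The face of a field of `bubble`. -/
def bubbleFace : Dart 4 2 0 → Fin 4 ⊕ Fin 1
  | Sum.inl i => Sum.inl i
  | Sum.inr (Sum.inl v, a) => ![![Sum.inl 1, Sum.inl 0, Sum.inr 0, Sum.inl 2] a,
      ![Sum.inl 3, Sum.inl 2, Sum.inr 0, Sum.inl 0] a] v
  | Sum.inr (Sum.inr v, _) => v.elim0

lemma sameCycle_star (d d' : Dart 4 1 0) :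
    (facePerm star).SameCycle d d' ↔ starFace d = starFace d' :=
  sameCycle_iff_of_iterate starFace (Sum.elim Sum.inl Fin.elim0) (by decide +kernel)
    (by decide +kernel) d d'

lemma sameCycle_tadpole (d d' : Dart 2 1 0) :
    (facePerm tadpole).SameCycle d d' ↔ tadpoleFace d = tadpoleFace d' :=
  sameCycle_iff_of_iterate tadpoleFace (Sum.elim Sum.inl fun _ => Sum.inr (Sum.inl 0, 0))
    (by decide +kernel) (by decide +kernel) d d'

lemma sameCycle_bubble (d d' : Dart 4 2 0) :
    (facePerm bubble).SameCycle d d' ↔ bubbleFace d = bubbleFace d' :=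
  sameCycle_iff_of_iterate bubbleFace (Sum.elim Sum.inl fun _ => Sum.inr (Sum.inl 0, 2))
    (by decide +kernel) (by decide +kernel) d d'

lemma surjective_starFace : Function.Surjective starFace := by
  unfold Function.Surjective; decide +kernel

lemma surjective_tadpoleFace : Function.Surjective tadpoleFace := by
  unfold Function.Surjective; decide +kernel

lemma surjective_bubbleFace : Function.Surjective bubbleFace := by
  unfold Function.Surjective; decide +kernel

lemma isContraction_of_isRight {σ : Equiv.Perm (Dart k n₁ n₂)}
    (h : (∀ d, σ (σ d) = d) ∧ (∀ d, σ d ≠ d) ∧ ∀ i, (σ (Sum.inl i)).isRight) :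
    IsContraction σ :=
  ⟨h.1, h.2.1, fun i => Sum.isRight_iff.1 (h.2.2 i)⟩

lemma isAdmissible_star : IsAdmissible star := by
  refine ⟨isContraction_of_isRight (by decide +kernel), isOnePI_of_subsingleton (by decide) _, ?_, ?_⟩
  · rw [numFaces_eq_card _ sameCycle_star surjective_starFace]
    simp
  · intro i j h
    simpa [starFace] using (sameCycle_star _ _).1 h

lemma isAdmissible_tadpole : IsAdmissible tadpole := by
  refine ⟨isContraction_of_isRight (by decide +kernel), isOnePI_of_subsingleton (by decide) _, ?_, ?_⟩
  · rw [numFaces_eq_card _ sameCycle_tadpole surjective_tadpoleFace]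
    simp
  · intro i j h
    simpa [tadpoleFace] using (sameCycle_tadpole _ _).1 h

/-- Whichever of the two links is cut, the other still joins the vertices. -/
lemma isOnePI_bubble : IsOnePI bubble := by
  have key (h h' : Vertex 2 0 × Fin 4) (hh : bubble (Sum.inr h) = Sum.inr h') (v w : Vertex 2 0) :
      Relation.ReflTransGen (VertexAdj bubble {Sum.inr h, Sum.inr h'}) v w := by
    have : ∀ (h : Vertex 2 0 × Fin 4) (v w : Vertex 2 0), v = w ∨ ∃ i j : Fin 4,
        bubble (Sum.inr (v, i)) = Sum.inr (w, j) ∧ (v, i) ≠ h ∧ (w, j) ≠ h ∧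
          bubble (Sum.inr h) ≠ Sum.inr (v, i) ∧ bubble (Sum.inr h) ≠ Sum.inr (w, j) := by
      decide +kernel
    rcases this h v w with rfl | ⟨i, j, h1, h2, h3, h4, h5⟩
    · exact .refl
    · rw [hh] at h4 h5
      refine .single ⟨i, j, h1, ?_, ?_⟩
      · rintro (h | h)
        exacts [h2 (Sum.inr_injective h), h4 (Set.mem_singleton_iff.1 h).symm]
      · rintro (h | h)
        exacts [h3 (Sum.inr_injective h), h5 (Set.mem_singleton_iff.1 h).symm]
  refine ⟨fun v w => (key (Sum.inl 0, 1) (Sum.inl 1, 2) (by decide +kernel) v w).lift id ?_, key⟩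
  rintro a b ⟨i, j, h, -, -⟩
  exact ⟨i, j, h, by simp, by simp⟩

lemma isAdmissible_bubble : IsAdmissible bubble := by
  refine ⟨isContraction_of_isRight (by decide +kernel), isOnePI_bubble, ?_, ?_⟩
  · rw [numFaces_eq_card _ sameCycle_bubble surjective_bubbleFace]
    simp
  · intro i j h
    simpa [bubbleFace] using (sameCycle_bubble _ _).1 h

end Classification

/-! ### Classification of the contractions of lowest order -/

section Classification

variable {k n₁ n₂ : ℕ}

lemma IsContraction.apply_eq {σ : Equiv.Perm (Dart k n₁ n₂)} (h : IsContraction σ)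
    {d d' : Dart k n₁ n₂} (hd : σ d = d') : σ d' = d := by
  rw [← hd, h.1]

lemma lt_numFaces_of_isPlanarRegular {σ : Equiv.Perm (Dart k n₁ n₂)} (h : IsPlanarRegular σ)
    {m : ℕ} (hm : 2 * (n₁ + n₂ + 1) + 2 * m < k + (n₁ + n₂) * 4 + 4) : m < numFaces σ := by
  have := h.1
  simp only [Fintype.card_sum, Fintype.card_fin, Fintype.card_prod] at this
  omega

/-- All four fields of the vertex are external legs, and the faces force the legs to be attached in
reversed cyclic order. Only the rotation remains free; shifting the external fields would repeat the
same contractions, hence the shift `0`. -/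
theorem exists_eq_relabel_star (φ : Vertex 1 0 ≃ Vertex n₁ n₂)
    {σ : Equiv.Perm (Dart 4 n₁ n₂)} (h : IsAdmissible σ) :
    ∃ a : Fin 4, σ = (relabel 0 φ fun _ => a).permCongr star := by
  obtain ⟨hc, -, hp⟩ := h
  have hn : n₁ + n₂ = 1 := by simpa using (Fintype.card_congr φ).symm
  have hv (v : Vertex n₁ n₂) : v = φ (Sum.inl 0) := by
    obtain ⟨w, rfl⟩ := φ.surjective v
    congr 1
    revert w
    decide
  have hg (i : Fin 4) : ∃ a, σ (Sum.inl i) = Sum.inr (φ (Sum.inl 0), a) := by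
    obtain ⟨⟨v, a⟩, h⟩ := hc.2.2 i
    exact ⟨a, by rw [h, hv v]⟩
  choose g hg using hg
  have hatt (a : Fin 4) : ∃ j, σ (Sum.inr (φ (Sum.inl 0), a)) = Sum.inl j :=
    exists_inl_of_notMem (k := 3) hc ∅ (by simp) (by simp [hn]) (by simp)
  have hstep (i : Fin 4) : g (i - 1) = g i + 1 := by
    obtain ⟨j, hj⟩ := hatt (g i + 1)
    have h1 : (facePerm σ).SameCycle (Sum.inl i) (Sum.inr (φ (Sum.inl 0), g i + 1)) := by
      rw [← facePerm_of_eq_inr (k := 3) (hg i), Equiv.Perm.sameCycle_apply_right]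
    have h2 := add_one_eq_of_sameCycle (k := 3) hp h1 hj
    have h3 := hc.apply_eq hj
    have h4 : i - 1 = j := by rw [← h2, add_sub_cancel_right]
    rw [h4]
    rw [hg j] at h3
    simpa using h3
  have hgi (i : Fin 4) : g i = -i + g 0 := by
    have : ∀ g : Fin 4 → Fin 4, (∀ i, g (i - 1) = g i + 1) → ∀ i, g i = -i + g 0 := by
      decide +kernel
    exact this g hstep i
  have key (i : Fin 4) : σ (Sum.inl i) = Sum.inr (φ (Sum.inl 0), -i + g 0) := by
    rw [hg, hgi]
  refine ⟨g 0, eq_permCongr_relabel (k := 3) ?_⟩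
  rintro (i | ⟨v | v, a⟩)
  · rw [relabel_inl, add_zero, key]
    rfl
  · obtain rfl : v = 0 := Subsingleton.elim _ _
    have := hc.apply_eq (key (-a))
    rw [neg_neg] at this
    rw [relabel_inr, this]
    change _ = Sum.inl (-a + 0)
    rw [add_zero]
  · exact v.elim0

/-- Euler's formula gives three faces for two external indices, hence an inner face. It cannot run
into a field attached to an external one, so it closes up at once and the two contracted fields are
neighbors. -/
theorem exists_eq_relabel_tadpole (φ : Vertex 1 0 ≃ Vertex n₁ n₂)
    {σ : Equiv.Perm (Dart 2 n₁ n₂)} (h : IsAdmissible σ) :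
    ∃ (s : Fin 2) (a : Fin 4), σ = (relabel s φ fun _ => a).permCongr tadpole := by
  obtain ⟨hc, -, hp⟩ := h
  have hn : n₁ + n₂ = 1 := by simpa using (Fintype.card_congr φ).symm
  have hv (v : Vertex n₁ n₂) : v = φ (Sum.inl 0) := by
    obtain ⟨w, rfl⟩ := φ.surjective v
    congr 1
    revert w
    decide
  set v := φ (Sum.inl 0) with hvdef
  obtain ⟨x, hx⟩ := exists_inner_face (lt_numFaces_of_isPlanarRegular hp (m := 2) (by omega))
  obtain ⟨w, a, rfl⟩ := exists_inr_of_inner (k := 1) hx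
  obtain rfl := hv w
  obtain ⟨b, hab⟩ : ∃ b, σ (Sum.inr (v, a)) = Sum.inr (v, b) := by
    rcases hxa : σ (Sum.inr (v, a)) with j | ⟨w, b⟩
    · exact absurd hxa (not_eq_inl_of_inner (k := 1) hx j)
    · exact ⟨b, by rw [hv w]⟩
  have hne : a ≠ b := by
    rintro rfl
    exact hc.2.1 _ hab
  have hba := hc.apply_eq hab
  have hatt (c : Fin 4) (h1 : c ≠ a) (h2 : c ≠ b) : ∃ j, σ (Sum.inr (v, c)) = Sum.inl j := by
    refine exists_inl_of_notMem (k := 1) hc {(v, a), (v, b)} ?_ ?_ (by simp [h1, h2])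
    · intro y hy
      rw [Finset.mem_insert, Finset.mem_singleton] at hy
      rcases hy with rfl | rfl
      exacts [⟨_, hab⟩, ⟨_, hba⟩]
    · rw [Finset.card_pair (by simpa using hne)]
      omega
  have hx' := inner_facePerm (k := 1) hx
  rw [facePerm_of_eq_inr (k := 1) hab] at hx'
  -- The inner face continues at `b + 1`; of the two fields contracted inside the vertex, only `a`
  -- can be that field.
  have hb1 : b + 1 = a := by
    by_contra hcon
    obtain ⟨j, hj⟩ := hatt (b + 1) hcon (by simp)
    exact not_eq_inl_of_inner (k := 1) hx' j hj
  obtain rfl : b = a + 3 := by rw [← hb1, add_assoc]; simp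
  obtain ⟨t, ht⟩ := hatt (a + 1) (by simp) (by simp)
  obtain ⟨u, hu⟩ := hatt (a + 2) (by simp) (by simp)
  have hut : u + 1 = t := by
    refine add_one_eq_of_sameCycle (k := 1) hp ?_ hu
    have := facePerm_of_eq_inr (k := 1) (hc.apply_eq ht)
    rw [add_assoc] at this
    change _ = Sum.inr (v, a + 2) at this
    rw [← this, Equiv.Perm.sameCycle_apply_right]
  subst hut
  refine ⟨u, a, eq_permCongr_relabel (k := 1) ?_⟩
  have hu' := hc.apply_eq hu
  have ht' := hc.apply_eq ht
  rintro (i | ⟨w | w, c⟩)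
  · fin_cases i
    · simpa [tadpole, add_comm, ← hvdef] using hu'
    · simpa [tadpole, add_comm, ← hvdef] using ht'
  · obtain rfl : w = 0 := Subsingleton.elim _ _
    fin_cases c
    · simpa [tadpole, add_comm, ← hvdef] using hab
    · simpa [tadpole, add_comm, ← hvdef] using ht
    · simpa [tadpole, add_comm, ← hvdef] using hu
    · simpa [tadpole, add_comm, ← hvdef] using hba
  · exact w.elim0

lemma rel_of_reflTransGen {α : Type*} {r : α → α → Prop} {v w : α} (hvw : v ≠ w)
    (hall : ∀ x, x = v ∨ x = w) (h : Relation.ReflTransGen r v w) : r v w := by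
  have key : ∀ x, Relation.ReflTransGen r v x → x = v ∨ r v w := by
    intro x hx
    induction hx with
    | refl => exact .inl rfl
    | @tail b c _ hbc ih =>
      rcases hall c with rfl | rfl
      · exact .inl rfl
      · rcases ih with rfl | ih
        · exact .inr hbc
        · exact .inr ih
  exact (key w h).resolve_left hvw.symm

/-- Connectedness supplies one propagator between the two vertices, and irreducibility a second one
after the first has been cut. -/
lemma exists_two_links {σ : Equiv.Perm (Dart k n₁ n₂)} (h : IsOnePI σ) {v w : Vertex n₁ n₂}
    (hvw : v ≠ w) (hall : ∀ x, x = v ∨ x = w) :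
    ∃ i i' j j', i ≠ i' ∧ j ≠ j' ∧ σ (Sum.inr (v, i)) = Sum.inr (w, j) ∧
      σ (Sum.inr (v, i')) = Sum.inr (w, j') := by
  obtain ⟨i, j, hij, -, -⟩ := rel_of_reflTransGen hvw hall (h.1 v w)
  obtain ⟨i', j', hij', h1, h2⟩ := rel_of_reflTransGen hvw hall (h.2 _ _ hij v w)
  refine ⟨i, i', j, j', ?_, ?_, hij, hij'⟩
  · rintro rfl
    simp at h1
  · rintro rfl
    simp at h2

lemma exists_inl_of_two_links {σ : Equiv.Perm (Dart 4 n₁ n₂)} (hc : IsContraction σ)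
    {v w : Vertex n₁ n₂} (hvw : v ≠ w) (hn : n₁ + n₂ = 2)
    {i i' j j' : Fin 4} (hi : i ≠ i') (hj : j ≠ j') (h1 : σ (Sum.inr (v, i)) = Sum.inr (w, j))
    (h2 : σ (Sum.inr (v, i')) = Sum.inr (w, j')) {y : Vertex n₁ n₂ × Fin 4} (e1 : y ≠ (v, i))
    (e2 : y ≠ (v, i')) (e3 : y ≠ (w, j)) (e4 : y ≠ (w, j')) :
    ∃ t, σ (Sum.inr y) = Sum.inl t := by
  refine exists_inl_of_notMem (k := 3) hc {(v, i), (v, i'), (w, j), (w, j')} ?_ ?_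
    (by simp [e1, e2, e3, e4])
  · intro y hy
    simp only [Finset.mem_insert, Finset.mem_singleton] at hy
    rcases hy with rfl | rfl | rfl | rfl
    exacts [⟨_, h1⟩, ⟨_, h2⟩, ⟨_, hc.apply_eq h1⟩, ⟨_, hc.apply_eq h2⟩]
  · rw [Finset.card_insert_of_notMem (by simp [hi, hvw]),
      Finset.card_insert_of_notMem (by simp [hvw]), Finset.card_pair (by simpa using hj)]
    omega

/-- With two links between two vertices, a face that contains none of the external fields fixes
the contraction up to the choice of rotations. -/
lemma exists_bubble_of_links {σ : Equiv.Perm (Dart 4 n₁ n₂)} (hc : IsContraction σ)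
    (hp : IsPlanarRegular σ) {v w : Vertex n₁ n₂} (hvw : v ≠ w) (hn : n₁ + n₂ = 2)
    {i i' j j' : Fin 4} (hi : i ≠ i') (hj : j ≠ j') (h1 : σ (Sum.inr (v, i)) = Sum.inr (w, j))
    (h2 : σ (Sum.inr (v, i')) = Sum.inr (w, j'))
    (hx : ∀ t, ¬ (facePerm σ).SameCycle (Sum.inr (v, i)) (Sum.inl t)) :
    ∃ a b s, σ (Sum.inr (v, a + 1)) = Sum.inr (w, b + 2) ∧
      σ (Sum.inr (v, a + 2)) = Sum.inr (w, b + 1) ∧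
      σ (Sum.inr (v, a)) = Sum.inl s ∧ σ (Sum.inr (v, a + 3)) = Sum.inl (s + 1) ∧
      σ (Sum.inr (w, b)) = Sum.inl (s + 2) ∧ σ (Sum.inr (w, b + 3)) = Sum.inl (s + 3) := by
  have h1' := hc.apply_eq h1
  have h2' := hc.apply_eq h2
  have hatt (y : Vertex n₁ n₂ × Fin 4) (e1 : y ≠ (v, i)) (e2 : y ≠ (v, i')) (e3 : y ≠ (w, j))
      (e4 : y ≠ (w, j')) : ∃ t, σ (Sum.inr y) = Sum.inl t :=
    exists_inl_of_two_links hc hvw hn hi hj h1 h2 e1 e2 e3 e4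
  have hx1 := inner_facePerm (k := 3) hx
  rw [facePerm_of_eq_inr (k := 3) h1] at hx1
  -- The inner face reaches `(w, j + 1)`, which must be the end of a link; `j'` is the only other
  -- one at `w`. The return to `v` fixes `i` likewise, so the links are attached in opposite orders.
  have hj' : j' = j + 1 := by
    by_contra hcon
    obtain ⟨t, ht⟩ := hatt (w, j + 1) (by simp [hvw.symm]) (by simp [hvw.symm]) (by simp)
      (by simpa using Ne.symm hcon)
    exact not_eq_inl_of_inner (k := 3) hx1 t ht
  subst hj'
  have hx2 := inner_facePerm (k := 3) hx1
  rw [facePerm_of_eq_inr (k := 3) h2'] at hx2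
  have hi' : i = i' + 1 := by
    by_contra hcon
    obtain ⟨t, ht⟩ := hatt (v, i' + 1) (by simpa using Ne.symm hcon) (by simp) (by simp [hvw])
      (by simp [hvw])
    exact not_eq_inl_of_inner (k := 3) hx2 t ht
  subst hi'
  obtain ⟨a, rfl⟩ : ∃ a, i' = a + 1 := ⟨i' - 1, by simp⟩
  obtain ⟨b, rfl⟩ : ∃ b, j = b + 1 := ⟨j - 1, by simp⟩
  have e2 (c : Fin 4) : c + 1 + 1 = c + 2 := by rw [add_assoc]; rfl
  have e3 (c : Fin 4) : c + 3 + 1 = c := by rw [add_assoc]; simp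
  have e4 (c : Fin 4) : c + 2 + 1 = c + 3 := by rw [add_assoc]; rfl
  rw [e2] at h1 h1' h2 h2'
  have hv {c : Fin 4} (hc1 : c ≠ a + 1) (hc2 : c ≠ a + 2) : ∃ t, σ (Sum.inr (v, c)) = Sum.inl t :=
    hatt _ (by rw [e2]; simpa using hc2) (by simpa using hc1) (by simp [hvw]) (by simp [hvw])
  have hw {c : Fin 4} (hc1 : c ≠ b + 1) (hc2 : c ≠ b + 2) : ∃ t, σ (Sum.inr (w, c)) = Sum.inl t :=
    hatt _ (by simp [hvw.symm]) (by simp [hvw.symm]) (by simpa using hc1)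
      (by rw [e2]; simpa using hc2)
  obtain ⟨s, hs⟩ := hv (c := a) (by simp) (by simp)
  obtain ⟨s₁, hs₁⟩ := hv (c := a + 3) (by simp) (by simp)
  obtain ⟨s₂, hs₂⟩ := hw (c := b) (by simp) (by simp)
  obtain ⟨s₃, hs₃⟩ := hw (c := b + 3) (by simp) (by simp)
  have step {d d' : Dart 4 n₁ n₂} {i : Fin 4} (h : (facePerm σ).SameCycle (Sum.inl i) d)
      (hd : facePerm σ d = d') : (facePerm σ).SameCycle (Sum.inl i) d' := by
    rw [← hd, Equiv.Perm.sameCycle_apply_right]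
    exact h
  have f1 := facePerm_of_eq_inr (k := 3) (hc.apply_eq hs₁)
  have f2 := facePerm_of_eq_inr (k := 3) (hc.apply_eq hs)
  have f3 := facePerm_of_eq_inr (k := 3) h2
  have f4 := facePerm_of_eq_inr (k := 3) (hc.apply_eq hs₃)
  rw [e3] at f1 f4
  rw [e4] at f3
  -- The remaining fields are external legs. Three outer faces determine their cyclic order, leaving
  -- only the shift `s`.
  have hs1 : s + 1 = s₁ := add_one_eq_of_sameCycle (k := 3) hp (step (.refl _ _) f1) hs
  have hs3 : s₃ + 1 = s := add_one_eq_of_sameCycle (k := 3) hp (step (step (.refl _ _) f2) f3) hs₃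
  have hs2 : s₂ + 1 = s₃ := add_one_eq_of_sameCycle (k := 3) hp (step (.refl _ _) f4) hs₂
  subst hs2 hs3
  have t1 : ∀ t : Fin 4, t + 1 + 1 + 2 = t := by decide
  have t2 : ∀ t : Fin 4, t + 1 + 1 + 3 = t + 1 := by decide
  refine ⟨a, b, _, h2, h1, hs, by rw [hs₁, hs1], ?_, ?_⟩
  · rw [hs₂, t1]
  · rw [hs₃, t2]

/-- Two links use four fields and the external ones the other four; five faces for four external
indices give an inner face, which passes through the links. A single `φ` suffices, since exchanging
the vertices of `bubble` amounts to the shift by two. -/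
theorem exists_eq_relabel_bubble (φ : Vertex 2 0 ≃ Vertex n₁ n₂)
    {σ : Equiv.Perm (Dart 4 n₁ n₂)} (h : IsAdmissible σ) :
    ∃ (s a b : Fin 4), σ = (relabel s φ (Sum.elim ![a, b] Fin.elim0)).permCongr bubble := by
  obtain ⟨hc, h1, hp⟩ := h
  have hn : n₁ + n₂ = 2 := by simpa using (Fintype.card_congr φ).symm
  have hvw : φ (Sum.inl 0) ≠ φ (Sum.inl 1) := by simp
  have hall (x : Vertex n₁ n₂) : x = φ (Sum.inl 0) ∨ x = φ (Sum.inl 1) := by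
    obtain ⟨y, rfl⟩ := φ.surjective x
    simp only [EmbeddingLike.apply_eq_iff_eq]
    revert y
    decide
  set v := φ (Sum.inl 0) with hv
  set w := φ (Sum.inl 1) with hw
  obtain ⟨i, i', j, j', hi, hj, e1, e2⟩ := exists_two_links h1 hvw hall
  have inner_eq {x : Vertex n₁ n₂ × Fin 4}
      (hx : ∀ t, ¬ (facePerm σ).SameCycle (Sum.inr x) (Sum.inl t)) :
      x = (v, i) ∨ x = (v, i') ∨ x = (w, j) ∨ x = (w, j') := by
    by_contra! hcon
    obtain ⟨t, ht⟩ := exists_inl_of_two_links hc hvw hn hi hj e1 e2 hcon.1 hcon.2.1 hcon.2.2.1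
      hcon.2.2.2
    exact not_eq_inl_of_inner (k := 3) hx t ht
  have hx : ∃ a, ∀ t, ¬ (facePerm σ).SameCycle (Sum.inr (v, a)) (Sum.inl t) := by
    obtain ⟨x, hx⟩ := exists_inner_face (lt_numFaces_of_isPlanarRegular hp (m := 4) (by omega))
    obtain ⟨y, a, rfl⟩ := exists_inr_of_inner (k := 3) hx
    have hx' := inner_facePerm (k := 3) hx
    rcases inner_eq hx with h | h | h | h <;> rw [h] at hx hx'
    · exact ⟨i, hx⟩
    · exact ⟨i', hx⟩
    · rw [facePerm_of_eq_inr (k := 3) (hc.apply_eq e1)] at hx'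
      exact ⟨_, hx'⟩
    · rw [facePerm_of_eq_inr (k := 3) (hc.apply_eq e2)] at hx'
      exact ⟨_, hx'⟩
  obtain ⟨c, hx⟩ := hx
  have main : ∃ a b s, σ (Sum.inr (v, a + 1)) = Sum.inr (w, b + 2) ∧
      σ (Sum.inr (v, a + 2)) = Sum.inr (w, b + 1) ∧
      σ (Sum.inr (v, a)) = Sum.inl s ∧ σ (Sum.inr (v, a + 3)) = Sum.inl (s + 1) ∧
      σ (Sum.inr (w, b)) = Sum.inl (s + 2) ∧ σ (Sum.inr (w, b + 3)) = Sum.inl (s + 3) := by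
    rcases inner_eq hx with h | h | h | h
    · rw [h] at hx
      exact exists_bubble_of_links hc hp hvw hn hi hj e1 e2 hx
    · rw [h] at hx
      exact exists_bubble_of_links hc hp hvw hn hi.symm hj.symm e2 e1 hx
    · exact absurd (congrArg Prod.fst h) hvw
    · exact absurd (congrArg Prod.fst h) hvw
  obtain ⟨a, b, s, g1, g2, g3, g4, g5, g6⟩ := main
  have g1' := hc.apply_eq g1
  have g2' := hc.apply_eq g2
  have g3' := hc.apply_eq g3
  have g4' := hc.apply_eq g4
  have g5' := hc.apply_eq g5
  have g6' := hc.apply_eq g6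
  refine ⟨s, a, b, eq_permCongr_relabel (k := 3) ?_⟩
  rintro (i | ⟨y | y, c⟩)
  · fin_cases i
    · simpa [bubble, add_comm, ← hv] using g3'
    · simpa [bubble, add_comm, ← hv] using g4'
    · simpa [bubble, add_comm, ← hw] using g5'
    · simpa [bubble, add_comm, ← hw] using g6'
  · fin_cases y
    · fin_cases c
      · simpa [bubble, add_comm, ← hv, ← hw] using g3
      · simpa [bubble, add_comm, ← hv, ← hw] using g1
      · simpa [bubble, add_comm, ← hv, ← hw] using g2
      · simpa [bubble, add_comm, ← hv, ← hw] using g4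
    · fin_cases c
      · simpa [bubble, add_comm, ← hv, ← hw] using g5
      · simpa [bubble, add_comm, ← hv, ← hw] using g2'
      · simpa [bubble, add_comm, ← hv, ← hw] using g1'
      · simpa [bubble, add_comm, ← hv, ← hw] using g6
  · exact y.elim0

end Classification

section Threads

variable {k n₁ n₂ m₁ m₂ : ℕ}

/-! ### Color threads -/

/-- The pairing of the fields of a vertex by color: `0 1 | 2 3`, `0 3 | 1 2` or `0 2 | 1 3`. -/
def vertexPattern : Fin 3 → Fin 4 → Fin 4 :=
  ![![1, 0, 3, 2], ![3, 2, 1, 0], ![2, 3, 0, 1]]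

/-- The pairing of the fields of a vertex by color, counted from the field `r`. -/
def patternAt : Vertex n₁ n₂ → Fin 4 → Fin 3
  | Sum.inl _, r => ![0, 1, 0, 1] r
  | Sum.inr _, _ => 2

/-- The field of the same color at the same vertex, for arbitrary color patterns of the vertices. -/
def mateOf (t : Vertex n₁ n₂ → Fin 3) : Dart k n₁ n₂ → Dart k n₁ n₂
  | Sum.inl i => Sum.inl i
  | Sum.inr (v, a) => Sum.inr (v, vertexPattern (t v) a)

/-- A rotation is absorbed into the color pattern of the model vertex, so that colors need be
followed only on the model graphs with one of three patterns at each vertex. -/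
lemma colorMate_relabel (s : Fin (k + 1)) (φ : Vertex n₁ n₂ ≃ Vertex m₁ m₂)
    (ρ : Vertex n₁ n₂ → Fin 4) (d : Dart (k + 1) n₁ n₂) :
    colorMate (relabel s φ ρ d) = relabel s φ ρ (mateOf (fun v => patternAt (φ v) (ρ v)) d) := by
  have hpar : ∀ r a : Fin 4, parallelMate (a + r) = vertexPattern (![0, 1, 0, 1] r) a + r := by
    decide +kernel
  have hcross : ∀ r a : Fin 4, crossedMate (a + r) = vertexPattern 2 a + r := by decide +kernel
  rcases d with i | ⟨v, a⟩
  · rfl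
  · rw [relabel_inr, mateOf, relabel_inr]
    rcases φ v with w | w
    · rw [colorMate, hpar]; rfl
    · rw [colorMate, hcross]; rfl

/-- Colors are transported by `σ` and by `m`. -/
def threadSetoid {α : Type*} (σ m : α → α) : Setoid α :=
  Relation.EqvGen.setoid fun d d' => d' = σ d ∨ d' = m d

lemma colorSetoid_relabel (s : Fin (k + 1)) (φ : Vertex n₁ n₂ ≃ Vertex m₁ m₂)
    (ρ : Vertex n₁ n₂ → Fin 4) (σ : Equiv.Perm (Dart (k + 1) n₁ n₂)) (d d' : Dart (k + 1) n₁ n₂) :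
    (colorSetoid ((relabel s φ ρ).permCongr σ)).r (relabel s φ ρ d) (relabel s φ ρ d') ↔
      (threadSetoid σ (mateOf fun v => patternAt (φ v) (ρ v))).r d d' := by
  set Φ := relabel s φ ρ with hΦ
  set m : Dart (k + 1) n₁ n₂ → Dart (k + 1) n₁ n₂ := mateOf fun v => patternAt (φ v) (ρ v)
  constructor
  · intro h
    have key : ∀ x y, Relation.EqvGen
        (fun d d' => d' = (Φ.permCongr σ) d ∨ d' = colorMate d) x y →
        (threadSetoid σ m).r (Φ.symm x) (Φ.symm y) := by
      intro x y hxy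
      induction hxy with
      | rel x y hxy =>
        obtain ⟨x, rfl⟩ := Φ.surjective x
        refine .rel _ _ ?_
        rcases hxy with rfl | rfl
        · left
          rw [hΦ, permCongr_apply_relabel]
          simp
        · right
          rw [hΦ, colorMate_relabel]
          simp [m]
      | refl x => exact .refl _
      | symm x y _ ih => exact .symm _ _ ih
      | trans x y z _ _ ih1 ih2 => exact .trans _ _ _ ih1 ih2
    simpa using key _ _ h
  · intro h
    induction h with
    | rel x y hxy =>
      refine .rel _ _ ?_
      rcases hxy with rfl | rfl
      · left
        rw [hΦ, permCongr_apply_relabel]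
      · right
        rw [hΦ, colorMate_relabel]
    | refl x => exact .refl _
    | symm x y _ ih => exact .symm _ _ ih
    | trans x y z _ _ ih1 ih2 => exact .trans _ _ _ ih1 ih2

/-- The element with the smallest code among `b` and `n` steps along the thread of `d`. -/
def threadMin {α : Type*} (code : α → ℕ) (σ m : α → α) : ℕ → α → α → α
  | 0, b, _ => b
  | n + 1, b, d =>
    threadMin code σ m n
      (if code d < code b then if code (σ d) < code d then σ d else d
        else if code (σ d) < code b then σ d else b) (m (σ d))

lemma threadSetoid_threadMin {α : Type*} (code : α → ℕ) (σ m : α → α) (n : ℕ) :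
    ∀ b d : α, (threadSetoid σ m).r b d → (threadSetoid σ m).r b (threadMin code σ m n b d) := by
  induction n with
  | zero => exact fun b d _ => .refl b
  | succ n ih =>
    intro b d h
    have hσ : (threadSetoid σ m).r d (σ d) := .rel _ _ (.inl rfl)
    have hm : (threadSetoid σ m).r (σ d) (m (σ d)) := .rel _ _ (.inr rfl)
    have hbσ := (threadSetoid σ m).trans h hσ
    have hbm := (threadSetoid σ m).trans hbσ hm
    have key (c : α) (hc : (threadSetoid σ m).r b c) :
        (threadSetoid σ m).r b (threadMin code σ m n c (m (σ d))) :=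
      (threadSetoid σ m).trans hc (ih c _ ((threadSetoid σ m).trans ((threadSetoid σ m).symm hc) hbm))
    rw [threadMin]
    apply key
    split_ifs
    exacts [hbσ, h, hbσ, .refl b]

/-- A choice of representatives that is constant along the generating moves is a complete invariant
of the threads. -/
lemma threadSetoid_iff {α : Type*} {σ m : α → α} (L : α → α)
    (hσ : ∀ d, L (σ d) = L d) (hm : ∀ d, L (m d) = L d) (hL : ∀ d, (threadSetoid σ m).r d (L d))
    (d d' : α) : (threadSetoid σ m).r d d' ↔ L d = L d' := by
  constructor
  · intro h
    induction h with
    | rel x y h =>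
      rcases h with rfl | rfl
      exacts [(hσ x).symm, (hm x).symm]
    | refl x => rfl
    | symm x y _ ih => exact ih.symm
    | trans x y z _ _ ih1 ih2 => exact ih1.trans ih2
  · intro h
    refine (threadSetoid σ m).trans (hL d) ?_
    rw [h]
    exact (threadSetoid σ m).symm (hL d')

lemma numColorLoops_eq_card {α : Type*} [Fintype α] [DecidableEq α]
    {σ : Equiv.Perm (Dart k n₁ n₂)} (L : Dart k n₁ n₂ → α)
    (hL : ∀ d d', (colorSetoid σ).r d d' ↔ L d = L d') :
    numColorLoops σ = Fintype.card {y : α // (∃ d, L d = y) ∧ ∀ i, L (Sum.inl i) ≠ y} := by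
  classical
  unfold numColorLoops
  rw [← Nat.card_eq_fintype_card]
  let f : Quotient (colorSetoid σ) → α := Quotient.lift L fun a b hab => (hL a b).1 hab
  refine Nat.card_eq_of_bijective (fun q => ⟨f q.1, ?_, ?_⟩) ⟨?_, ?_⟩
  · obtain ⟨⟨d⟩, hq⟩ := q
    exact ⟨d, rfl⟩
  · obtain ⟨⟨d⟩, hq⟩ := q
    intro i hi
    exact hq i (Quotient.sound ((colorSetoid σ).symm ((hL _ _).2 hi)))
  · rintro ⟨⟨a⟩, ha⟩ ⟨⟨b⟩, hb⟩ h
    exact Subtype.ext (Quotient.sound ((hL _ _).2 (congrArg Subtype.val h)))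
  · rintro ⟨_, ⟨d, rfl⟩, hd⟩
    refine ⟨⟨Quotient.mk _ d, fun i hi => hd i ?_⟩, rfl⟩
    exact ((hL _ _).1 (Quotient.exact hi)).symm

/-- The color threads of a relabeled graph, from a map `L` that tells apart the color threads of
the original one. -/
lemma colorMatches_relabel_iff {α : Type*} (s : Fin (k + 1)) (φ : Vertex n₁ n₂ ≃ Vertex m₁ m₂)
    (ρ : Vertex n₁ n₂ → Fin 4) (σ : Equiv.Perm (Dart (k + 1) n₁ n₂))
    (L : Dart (k + 1) n₁ n₂ → α)
    (hL : ∀ d d', (threadSetoid σ (mateOf fun v => patternAt (φ v) (ρ v))).r d d' ↔ L d = L d')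
    (pattern : Equiv.Perm (Fin (k + 1))) :
    ColorMatches ((relabel s φ ρ).permCongr σ) pattern ↔
      ∀ i, L (Sum.inl i) = L (Sum.inl (pattern (i + s) - s)) := by
  unfold ColorMatches
  rw [← (Equiv.addRight s).forall_congr_right]
  refine forall_congr' fun i => ?_
  rw [← hL, ← colorSetoid_relabel s φ ρ σ, relabel_inl, relabel_inl, sub_add_cancel]
  rfl

lemma numColorLoops_relabel {α : Type*} [Fintype α] [DecidableEq α]
    (s : Fin (k + 1)) (φ : Vertex n₁ n₂ ≃ Vertex m₁ m₂)
    (ρ : Vertex n₁ n₂ → Fin 4) (σ : Equiv.Perm (Dart (k + 1) n₁ n₂))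
    (L : Dart (k + 1) n₁ n₂ → α)
    (hL : ∀ d d', (threadSetoid σ (mateOf fun v => patternAt (φ v) (ρ v))).r d d' ↔ L d = L d') :
    numColorLoops ((relabel s φ ρ).permCongr σ) =
      Fintype.card {y : α // (∃ d, L d = y) ∧ ∀ i, L (Sum.inl i) ≠ y} := by
  rw [numColorLoops_eq_card (fun d => L ((relabel s φ ρ).symm d))]
  · refine Fintype.card_congr (Equiv.subtypeEquivRight fun y => ?_)
    refine and_congr ?_ ?_
    · exact (relabel s φ ρ).symm.exists_congr_left.trans (by simp)
    · simp only [relabel_symm_inl]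
      exact (Equiv.subRight s).forall_congr_right (q := fun i => L (Sum.inl i) ≠ y)
  · intro d d'
    obtain ⟨d, rfl⟩ := (relabel s φ ρ).surjective d
    obtain ⟨d', rfl⟩ := (relabel s φ ρ).surjective d'
    rw [colorSetoid_relabel, hL]
    simp

/-- A numbering of the fields. -/
def dartCode : Dart k n₁ n₂ → ℕ
  | Sum.inl i => i
  | Sum.inr (Sum.inl v, a) => k + 4 * v + a
  | Sum.inr (Sum.inr v, a) => k + 4 * (n₁ + v) + a

/-- The first field on the color thread of a field. -/
def threadLabel (σ : Equiv.Perm (Dart k n₁ n₂)) (t : Vertex n₁ n₂ → Fin 3) (d : Dart k n₁ n₂) :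
    Dart k n₁ n₂ :=
  threadMin dartCode σ (mateOf t) 7 d d

/-- The label always lies on the thread of its field, so only constancy along the moves has to be
checked. That check also certifies that seven steps suffice in the graph at hand. -/
lemma threadSetoid_iff_threadLabel {σ : Equiv.Perm (Dart k n₁ n₂)} {t : Vertex n₁ n₂ → Fin 3}
    (h : ∀ d, threadLabel σ t (σ d) = threadLabel σ t d ∧
      threadLabel σ t (mateOf t d) = threadLabel σ t d) (d e : Dart k n₁ n₂) :
    (threadSetoid σ (mateOf t)).r d e ↔ threadLabel σ t d = threadLabel σ t e :=
  threadSetoid_iff _ (fun d => (h d).1) (fun d => (h d).2)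
    (fun d => threadSetoid_threadMin _ _ _ _ d d (.refl d)) d e

/-- A pair of color patterns for the vertices of `bubble`. -/
def bubblePattern (x y : Fin 3) : Vertex 2 0 → Fin 3 := Sum.elim ![x, y] Fin.elim0

lemma threadLabel_bubble : ∀ (x y : Fin 3) (d : Dart 4 2 0),
    threadLabel bubble (bubblePattern x y) (bubble d) = threadLabel bubble (bubblePattern x y) d ∧
    threadLabel bubble (bubblePattern x y) (mateOf (bubblePattern x y) d) =
      threadLabel bubble (bubblePattern x y) d := by
  decide +kernel

lemma threadLabel_star : ∀ (x : Fin 3) (d : Dart 4 1 0),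
    threadLabel star (fun _ => x) (star d) = threadLabel star (fun _ => x) d ∧
    threadLabel star (fun _ => x) (mateOf (fun _ => x) d) = threadLabel star (fun _ => x) d := by
  decide +kernel

lemma threadLabel_tadpole : ∀ (x : Fin 3) (d : Dart 2 1 0),
    threadLabel tadpole (fun _ => x) (tadpole d) = threadLabel tadpole (fun _ => x) d ∧
    threadLabel tadpole (fun _ => x) (mateOf (fun _ => x) d) =
      threadLabel tadpole (fun _ => x) d := by
  decide +kernel

/-- The external field on the thread of an external field of `bubble`. -/
def bubblePartner (x y : Fin 3) : Fin 4 → Fin 4 :=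
  vertexPattern (![![1, 0, 2], ![0, 0, 0], ![2, 0, 1]] x y)

/-- A vertex of pattern `1` joins its own two external legs, and the other pair is then joined as
well: `01|23`. Otherwise the threads cross both vertices; equal patterns give `03|12` and different
ones `02|13`. -/
lemma threadLabel_bubble_inl : ∀ (x y : Fin 3) (i j : Fin 4),
    threadLabel bubble (bubblePattern x y) (Sum.inl i) =
      threadLabel bubble (bubblePattern x y) (Sum.inl j) ↔ j = i ∨ j = bubblePartner x y i := by
  decide +kernel

/-- A loop closes exactly when both vertices pair the two fields `1` and `2` that carry the links.
-/
lemma card_loops_bubble : ∀ x y : Fin 3, Fintype.card {z : Dart 4 2 0 //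
    (∃ d, threadLabel bubble (bubblePattern x y) d = z) ∧
      ∀ i, threadLabel bubble (bubblePattern x y) (Sum.inl i) ≠ z} =
    if x = 1 ∧ y = 1 then 1 else 0 := by
  decide +kernel

lemma threadLabel_star_inl : ∀ (x : Fin 3) (i j : Fin 4),
    threadLabel star (fun _ => x) (Sum.inl i) = threadLabel star (fun _ => x) (Sum.inl j) ↔
      j = i ∨ j = -vertexPattern x (-i) := by
  decide +kernel

lemma card_loops_star : ∀ x : Fin 3, Fintype.card {z : Dart 4 1 0 //
    (∃ d, threadLabel star (fun _ => x) d = z) ∧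
      ∀ i, threadLabel star (fun _ => x) (Sum.inl i) ≠ z} = 0 := by
  decide +kernel

lemma threadLabel_tadpole_inl : ∀ (x : Fin 3) (i j : Fin 2),
    threadLabel tadpole (fun _ => x) (Sum.inl i) =
      threadLabel tadpole (fun _ => x) (Sum.inl j) := by
  decide +kernel

/-- Pattern `1` pairs the fields `0` and `3`, which the tadpole contracts with each other. -/
lemma card_loops_tadpole : ∀ x : Fin 3, Fintype.card {z : Dart 2 1 0 //
    (∃ d, threadLabel tadpole (fun _ => x) d = z) ∧
      ∀ i, threadLabel tadpole (fun _ => x) (Sum.inl i) ≠ z} = if x = 1 then 1 else 0 := by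
  decide +kernel

end Threads

/-! ### The two- and four-point coefficients of lowest order -/

section Coefficients

variable {k n₁ n₂ : ℕ}

/-! ### Amplitudes -/

lemma mem_internalEdges {σ : Equiv.Perm (Dart k n₁ n₂)} {b : Sym2 (Dart k n₁ n₂)} :
    b ∈ internalEdges σ ↔ ∃ d, (d.isRight ∧ (σ d).isRight) ∧ s(d, σ d) = b := by
  classical
  simp [internalEdges]

lemma internalEdges_star : internalEdges star = ∅ := by
  have h : ∀ d, ¬ (Sum.isRight d ∧ (star d).isRight) := by decide +kernel
  refine Finset.eq_empty_of_forall_notMem fun b hb => ?_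
  obtain ⟨d, hd, -⟩ := mem_internalEdges.1 hb
  exact h d hd

lemma internalEdges_tadpole :
    internalEdges tadpole = {s(Sum.inr (Sum.inl 0, 0), Sum.inr (Sum.inl 0, 3))} := by
  have h : ∀ d, Sum.isRight d ∧ (tadpole d).isRight →
      d = Sum.inr (Sum.inl 0, 0) ∧ tadpole d = Sum.inr (Sum.inl 0, 3) ∨
      d = Sum.inr (Sum.inl 0, 3) ∧ tadpole d = Sum.inr (Sum.inl 0, 0) := by decide +kernel
  ext b
  rw [mem_internalEdges, Finset.mem_singleton]
  constructor
  · rintro ⟨d, hd, rfl⟩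
    exact Sym2.eq_iff.2 (h d hd)
  · rintro rfl
    exact ⟨Sum.inr (Sum.inl 0, 0), ⟨rfl, rfl⟩, rfl⟩

lemma internalEdges_bubble [DecidableEq (Sym2 (Dart 4 2 0))] :
    internalEdges bubble = {s(Sum.inr (Sum.inl 0, 1), Sum.inr (Sum.inl 1, 2)),
      s(Sum.inr (Sum.inl 0, 2), Sum.inr (Sum.inl 1, 1))} := by
  have h : ∀ d, Sum.isRight d ∧ (bubble d).isRight →
      d = Sum.inr (Sum.inl 0, 1) ∨ d = Sum.inr (Sum.inl 1, 2) ∨ d = Sum.inr (Sum.inl 0, 2) ∨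
        d = Sum.inr (Sum.inl 1, 1) := by decide +kernel
  ext b
  rw [mem_internalEdges, Finset.mem_insert, Finset.mem_singleton]
  constructor
  · rintro ⟨d, hd, rfl⟩
    rcases h d hd with rfl | rfl | rfl | rfl
    exacts [.inl rfl, .inl Sym2.eq_swap, .inr rfl, .inr Sym2.eq_swap]
  · rintro (rfl | rfl)
    · exact ⟨Sum.inr (Sum.inl 0, 1), ⟨rfl, rfl⟩, rfl⟩
    · exact ⟨Sum.inr (Sum.inl 0, 2), ⟨rfl, rfl⟩, rfl⟩

/-- The point of the plane with the coordinates of an element of the box. -/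
def boxPoint {Λ : ℕ} (p : Box Λ) : ℝ × ℝ := (((p.1 : ℕ) : ℝ), ((p.2 : ℕ) : ℝ))

/-- The sum over one summed index of the propagator. -/
def tadpoleSum (μ : ℝ) (Λ : ℕ) (m : ℝ × ℝ) : ℝ := ∑ p : Box Λ, propagator μ (boxPoint p) m

lemma amplitude_star (μ : ℝ) (Λ : ℕ) (e : Fin 4 → ℝ × ℝ) : amplitude star μ Λ e = 1 := by
  rw [amplitude_eq_sum starFace sameCycle_star (fun _ => rfl) surjective_starFace,
    internalEdges_star]
  simp

lemma amplitude_tadpole (μ : ℝ) (Λ : ℕ) (e : Fin 2 → ℝ × ℝ) :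
    amplitude tadpole μ Λ e = tadpoleSum μ Λ (e 0) := by
  rw [amplitude_eq_sum tadpoleFace sameCycle_tadpole (fun _ => rfl) surjective_tadpoleFace,
    internalEdges_tadpole]
  refine Fintype.sum_equiv (Equiv.funUnique (Fin 1) (Box Λ)) _ _ fun p => ?_
  rw [Finset.prod_singleton]
  rfl

lemma amplitude_bubble (μ : ℝ) (Λ : ℕ) :
    amplitude bubble μ Λ (fun _ => (0, 0)) = S1 μ Λ := by
  classical
  rw [amplitude_eq_sum bubbleFace sameCycle_bubble (fun _ => rfl) surjective_bubbleFace,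
    internalEdges_bubble]
  refine Fintype.sum_equiv (Equiv.funUnique (Fin 1) (Box Λ)) _ _ fun p => ?_
  rw [Finset.prod_pair (by decide)]
  change propagator μ (0, 0) (boxPoint (p 0)) * propagator μ (boxPoint (p 0)) (0, 0) = _
  simp only [propagator, boxPoint, zero_add, add_zero, Equiv.funUnique_apply, Fin.default_eq_zero]
  rw [one_div, sq, mul_inv]

/-! ### Sums over contractions -/

open Classical in
lemma onePICoeff_eq_sum {P : Type*} [Fintype P] (g : P → Equiv.Perm (Dart k n₁ n₂))
    (hinj : Function.Injective g) (hadm : ∀ p, IsAdmissible (g p))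
    (hsurj : ∀ σ, IsAdmissible σ → ∃ p, σ = g p) (pattern : Equiv.Perm (Fin k)) (μ N : ℝ) (Λ : ℕ)
    (e : Fin k → ℝ × ℝ) :
    onePICoeff pattern μ N Λ e n₁ n₂ =
      ((-1 / 2 : ℝ) ^ n₁ / (n₁.factorial : ℝ)) * ((-1 / 4 : ℝ) ^ n₂ / (n₂.factorial : ℝ)) *
        ∑ p, if ColorMatches (g p) pattern then N ^ numColorLoops (g p) * amplitude (g p) μ Λ e
          else 0 := by
  unfold onePICoeff
  congr 1
  rw [← Finset.sum_filter]
  symm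
  refine Finset.sum_bij (fun p _ => g p) (fun p hp => ?_) (fun p _ q _ h => hinj h)
    (fun σ hσ => ?_) fun p _ => rfl
  · obtain ⟨h1, h2, h3⟩ := hadm p
    rw [Finset.mem_filter] at hp ⊢
    exact ⟨Finset.mem_univ _, h1, h2, h3, hp.2⟩
  · rw [Finset.mem_filter] at hσ
    obtain ⟨p, rfl⟩ := hsurj σ ⟨hσ.2.1, hσ.2.2.1, hσ.2.2.2.1⟩
    exact ⟨p, by simpa using hσ.2.2.2.2, rfl⟩

/-- An external field must be contracted with a field of a vertex, and there is none. -/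
lemma onePICoeff_zero_zero (pattern : Equiv.Perm (Fin (k + 1))) (μ N : ℝ) (Λ : ℕ)
    (e : Fin (k + 1) → ℝ × ℝ) : onePICoeff pattern μ N Λ e 0 0 = 0 := by
  rw [onePICoeff_eq_sum (P := Empty) (fun p => p.elim) (fun p => p.elim) (fun p => p.elim)]
  · simp
  · rintro σ ⟨h, -⟩
    obtain ⟨⟨v | v, -⟩, -⟩ := h.2.2 0 <;> exact v.elim0

open Classical in
lemma sum_ite_mul_pow {P : Type*} [Fintype P] (c b : P → Prop) (N S : ℝ) :
    (∑ p, if c p then N ^ (if b p then 1 else 0) * S else 0) =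
      (Fintype.card {p // c p ∧ b p} * N + Fintype.card {p // c p ∧ ¬ b p}) * S := by
  have h (p : P) : (if c p then N ^ (if b p then 1 else 0) * S else 0) =
      (if c p ∧ b p then N * S else 0) + if c p ∧ ¬ b p then S else 0 := by
    by_cases hc : c p <;> by_cases hb : b p <;> simp [hc, hb]
  simp only [h]
  rw [Finset.sum_add_distrib, ← Finset.sum_filter, ← Finset.sum_filter, Finset.sum_const,
    Finset.sum_const, Fintype.card_subtype, Fintype.card_subtype, nsmul_eq_mul, nsmul_eq_mul]
  ring

/-! ### One vertex, four external fields -/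

lemma onePICoeff_star (φ : Vertex 1 0 ≃ Vertex n₁ n₂) (pattern : Equiv.Perm (Fin 4)) (μ N : ℝ)
    (Λ : ℕ) (e : Fin 4 → ℝ × ℝ) {c : ℕ}
    (hc : Fintype.card {a : Fin 4 // ∀ i, pattern i = i ∨
      pattern i = -vertexPattern (patternAt (φ (Sum.inl 0)) a) (-i)} = c) :
    onePICoeff pattern μ N Λ e n₁ n₂ =
      ((-1 / 2 : ℝ) ^ n₁ / (n₁.factorial : ℝ)) * ((-1 / 4 : ℝ) ^ n₂ / (n₂.factorial : ℝ)) * c := by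
  classical
  have hlab (a : Fin 4) (d d' : Dart 4 1 0) :
      (threadSetoid star (mateOf fun v => patternAt (φ v) a)).r d d' ↔
        threadLabel star (fun _ => patternAt (φ (Sum.inl 0)) a) d =
          threadLabel star (fun _ => patternAt (φ (Sum.inl 0)) a) d' := by
    rw [← threadSetoid_iff_threadLabel (threadLabel_star _)]
    have : (fun v => patternAt (φ v) a) = fun _ => patternAt (φ (Sum.inl 0)) a := by
      funext v
      congr 2
      revert v
      decide
    rw [this]
  rw [onePICoeff_eq_sum (fun a : Fin 4 => (relabel (k := 3) 0 φ fun _ => a).permCongr star) ?_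
    (fun a => isAdmissible_star.relabel _ _ _) fun σ hσ => exists_eq_relabel_star φ hσ]
  · congr 1
    rw [← hc, Fintype.card_subtype, Finset.card_filter, Nat.cast_sum]
    refine Finset.sum_congr rfl fun a _ => ?_
    rw [colorMatches_relabel_iff _ _ _ _ _ (hlab a), numColorLoops_relabel _ _ _ _ _ (hlab a),
      card_loops_star, amplitude_relabel, amplitude_star]
    simp only [add_zero, sub_zero, pow_zero, mul_one, Nat.cast_ite, Nat.cast_one, Nat.cast_zero]
    exact if_congr (forall_congr' fun i => threadLabel_star_inl _ _ _) rfl rfl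
  · intro a b h
    have := congrArg (fun σ => σ (relabel (k := 3) 0 φ (fun _ => b) (Sum.inl 0))) h
    simp only [permCongr_apply_relabel] at this
    rw [relabel_inl, ← relabel_inl (k := 3) 0 φ (fun _ => a), permCongr_apply_relabel] at this
    change Sum.inr (φ (Sum.inl 0), 0 + a) = Sum.inr (φ (Sum.inl 0), 0 + b) at this
    simpa using this

/-! ### One vertex, two external fields -/

lemma onePICoeff_tadpole (φ : Vertex 1 0 ≃ Vertex n₁ n₂) (μ N : ℝ) (Λ : ℕ)
    (e : Fin 2 → ℝ × ℝ) :
    onePICoeff (Equiv.swap (0 : Fin 2) 1) μ N Λ e n₁ n₂ =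
      ((-1 / 2 : ℝ) ^ n₁ / (n₁.factorial : ℝ)) * ((-1 / 4 : ℝ) ^ n₂ / (n₂.factorial : ℝ)) *
        ∑ s : Fin 2, ∑ a : Fin 4, N ^ (if patternAt (φ (Sum.inl 0)) a = 1 then 1 else 0) *
          tadpoleSum μ Λ (e s) := by
  classical
  have hlab (a : Fin 4) (d d' : Dart 2 1 0) :
      (threadSetoid tadpole (mateOf fun v => patternAt (φ v) a)).r d d' ↔
        threadLabel tadpole (fun _ => patternAt (φ (Sum.inl 0)) a) d =
          threadLabel tadpole (fun _ => patternAt (φ (Sum.inl 0)) a) d' := by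
    rw [← threadSetoid_iff_threadLabel (threadLabel_tadpole _)]
    have : (fun v => patternAt (φ v) a) = fun _ => patternAt (φ (Sum.inl 0)) a := by
      funext v
      congr 2
      revert v
      decide
    rw [this]
  rw [onePICoeff_eq_sum (fun p : Fin 2 × Fin 4 =>
      (relabel (k := 1) p.1 φ fun _ => p.2).permCongr tadpole) ?_
    (fun a => isAdmissible_tadpole.relabel _ _ _) fun σ hσ => by
      obtain ⟨s, a, h⟩ := exists_eq_relabel_tadpole φ hσ
      exact ⟨(s, a), h⟩]
  · congr 1
    rw [Fintype.sum_prod_type]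
    refine Finset.sum_congr rfl fun s _ => Finset.sum_congr rfl fun a _ => ?_
    rw [if_pos, numColorLoops_relabel _ _ _ _ _ (hlab a), card_loops_tadpole, amplitude_relabel,
      amplitude_tadpole, zero_add]
    rw [colorMatches_relabel_iff _ _ _ _ _ (hlab a)]
    exact fun i => threadLabel_tadpole_inl _ _ _
  · rintro ⟨s, a⟩ ⟨t, b⟩ h
    dsimp only at h
    have h1 := permCongr_apply_relabel (k := 1) s φ (fun _ => a) tadpole (Sum.inr (Sum.inl 0, 1))
    have h2 := permCongr_apply_relabel (k := 1) s φ (fun _ => a) tadpole (Sum.inr (Sum.inl 0, 2))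
    have h3 := permCongr_apply_relabel (k := 1) t φ (fun _ => b) tadpole (Sum.inr (Sum.inl 0, 0))
    have h4 := permCongr_apply_relabel (k := 1) t φ (fun _ => b) tadpole (Sum.inr (Sum.inl 0, 3))
    have h5 := permCongr_apply_relabel (k := 1) t φ (fun _ => b) tadpole (Sum.inr (Sum.inl 0, 2))
    rw [← h] at h3 h4 h5
    simp only [relabel_inr] at h1 h2 h3 h4 h5
    change _ = Sum.inl (1 + s) at h1
    change _ = Sum.inl (0 + s) at h2
    change _ = Sum.inr (φ (Sum.inl 0), 3 + b) at h3
    change _ = Sum.inr (φ (Sum.inl 0), 0 + b) at h4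
    change _ = Sum.inl (0 + t) at h5
    -- The rotation can be recovered: the two fields attached to external ones avoid the two
    -- contracted with each other.
    have hab : ∀ a b : Fin 4, 1 + a ≠ 0 + b → 2 + a ≠ 0 + b → 1 + a ≠ 3 + b → 2 + a ≠ 3 + b →
        a = b := by decide
    obtain rfl := hab a b (fun h => by rw [h, h3] at h1; cases h1)
      (fun h => by rw [h, h3] at h2; cases h2) (fun h => by rw [h, h4] at h1; cases h1)
      (fun h => by rw [h, h4] at h2; cases h2)
    rw [h2] at h5
    simpa using h5

/-! ### Two vertices, four external fields -/

/-- The parameters `(s, a, b)` of the relabelings of `bubble` in which the color threads connect the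
external fields according to `pattern`. -/
def BubbleMatches (v w : Vertex n₁ n₂) (pattern : Equiv.Perm (Fin 4))
    (p : Fin 4 × Fin 4 × Fin 4) : Prop :=
  ∀ i, pattern (i + p.1) - p.1 = i ∨
    pattern (i + p.1) - p.1 = bubblePartner (patternAt v p.2.1) (patternAt w p.2.2) i

/-- The parameters `(s, a, b)` of the relabelings of `bubble` with a closed color loop. -/
def BubbleHasLoop (v w : Vertex n₁ n₂) (p : Fin 4 × Fin 4 × Fin 4) : Prop :=
  patternAt v p.2.1 = 1 ∧ patternAt w p.2.2 = 1

instance (v w : Vertex n₁ n₂) (pattern : Equiv.Perm (Fin 4)) (p : Fin 4 × Fin 4 × Fin 4) :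
    Decidable (BubbleMatches v w pattern p) := by unfold BubbleMatches; infer_instance

instance (v w : Vertex n₁ n₂) (p : Fin 4 × Fin 4 × Fin 4) :
    Decidable (BubbleHasLoop v w p) := by unfold BubbleHasLoop; infer_instance

/-- Every relabeling has amplitude `S1 μ Λ` at vanishing external indices, so only color counts
remain: `c₁` matching parameters `(s, a, b)` with a closed loop and `c₀` without. -/
lemma onePICoeff_bubble (φ : Vertex 2 0 ≃ Vertex n₁ n₂) (pattern : Equiv.Perm (Fin 4)) (μ N : ℝ)
    (Λ : ℕ) {c₁ c₀ : ℕ}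
    (h₁ : Fintype.card {p // BubbleMatches (φ (Sum.inl 0)) (φ (Sum.inl 1)) pattern p ∧
      BubbleHasLoop (φ (Sum.inl 0)) (φ (Sum.inl 1)) p} = c₁)
    (h₀ : Fintype.card {p // BubbleMatches (φ (Sum.inl 0)) (φ (Sum.inl 1)) pattern p ∧
      ¬ BubbleHasLoop (φ (Sum.inl 0)) (φ (Sum.inl 1)) p} = c₀) :
    onePICoeff pattern μ N Λ (fun _ => (0, 0)) n₁ n₂ =
      ((-1 / 2 : ℝ) ^ n₁ / (n₁.factorial : ℝ)) * ((-1 / 4 : ℝ) ^ n₂ / (n₂.factorial : ℝ)) *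
        ((c₁ * N + c₀) * S1 μ Λ) := by
  classical
  have hlab (a b : Fin 4) (d d' : Dart 4 2 0) :
      (threadSetoid bubble (mateOf fun v => patternAt (φ v)
          ((Sum.elim ![a, b] Fin.elim0 : Vertex 2 0 → Fin 4) v))).r d d' ↔
        threadLabel bubble (bubblePattern (patternAt (φ (Sum.inl 0)) a)
          (patternAt (φ (Sum.inl 1)) b)) d =
        threadLabel bubble (bubblePattern (patternAt (φ (Sum.inl 0)) a)
          (patternAt (φ (Sum.inl 1)) b)) d' := by
    rw [← threadSetoid_iff_threadLabel (threadLabel_bubble _ _)]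
    have : (fun v => patternAt (φ v) ((Sum.elim ![a, b] Fin.elim0 : Vertex 2 0 → Fin 4) v)) =
        bubblePattern (patternAt (φ (Sum.inl 0)) a) (patternAt (φ (Sum.inl 1)) b) := by
      funext v
      rcases v with v | v
      · fin_cases v <;> rfl
      · exact v.elim0
    rw [this]
  rw [onePICoeff_eq_sum (fun p : Fin 4 × Fin 4 × Fin 4 =>
      (relabel (k := 3) p.1 φ (Sum.elim ![p.2.1, p.2.2] Fin.elim0)).permCongr bubble) ?_
    (fun a => isAdmissible_bubble.relabel _ _ _) fun σ hσ => by
      obtain ⟨s, a, b, h⟩ := exists_eq_relabel_bubble φ hσ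
      exact ⟨(s, a, b), h⟩]
  · congr 1
    rw [← h₁, ← h₀]
    have := sum_ite_mul_pow (BubbleMatches (φ (Sum.inl 0)) (φ (Sum.inl 1)) pattern)
      (BubbleHasLoop (φ (Sum.inl 0)) (φ (Sum.inl 1))) N (S1 μ Λ)
    convert this using 1
    swap
    · congr!
    refine Finset.sum_congr rfl fun p _ => ?_
    rw [colorMatches_relabel_iff _ _ _ _ _ (hlab _ _), numColorLoops_relabel _ _ _ _ _ (hlab _ _),
      card_loops_bubble, amplitude_relabel, amplitude_bubble]
    have hiff := forall_congr' fun i => threadLabel_bubble_inl (patternAt (φ (Sum.inl 0)) p.2.1)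
      (patternAt (φ (Sum.inl 1)) p.2.2) i (pattern (i + p.1) - p.1)
    by_cases h : BubbleMatches (φ (Sum.inl 0)) (φ (Sum.inl 1)) pattern p
    · rw [if_pos h, if_pos (hiff.2 h)]
      congr!
    · rw [if_neg h, if_neg fun h' => h (hiff.1 h')]
  · rintro ⟨s, a, b⟩ ⟨s', a', b'⟩ h
    dsimp only at h
    have g (c : Vertex 2 0 × Fin 4) := permCongr_apply_relabel (k := 3) s φ
      (Sum.elim ![a, b] Fin.elim0) bubble (Sum.inr c)
    have g' (c : Vertex 2 0 × Fin 4) := permCongr_apply_relabel (k := 3) s' φ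
      (Sum.elim ![a', b'] Fin.elim0) bubble (Sum.inr c)
    rw [← h] at g'
    set σ := (relabel (k := 3) s φ (Sum.elim ![a, b] Fin.elim0)).permCongr bubble
    have u0 : σ (Sum.inr (φ (Sum.inl 0), 0 + a)) = Sum.inl (0 + s) := g (Sum.inl 0, 0)
    have u3 : σ (Sum.inr (φ (Sum.inl 0), 3 + a)) = Sum.inl (1 + s) := g (Sum.inl 0, 3)
    have v0 : σ (Sum.inr (φ (Sum.inl 1), 0 + b)) = Sum.inl (2 + s) := g (Sum.inl 1, 0)
    have v3 : σ (Sum.inr (φ (Sum.inl 1), 3 + b)) = Sum.inl (3 + s) := g (Sum.inl 1, 3)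
    have u0' : σ (Sum.inr (φ (Sum.inl 0), 0 + a')) = Sum.inl (0 + s') := g' (Sum.inl 0, 0)
    have u1' : σ (Sum.inr (φ (Sum.inl 0), 1 + a')) = Sum.inr (φ (Sum.inl 1), 2 + b') :=
      g' (Sum.inl 0, 1)
    have u2' : σ (Sum.inr (φ (Sum.inl 0), 2 + a')) = Sum.inr (φ (Sum.inl 1), 1 + b') :=
      g' (Sum.inl 0, 2)
    have v1' : σ (Sum.inr (φ (Sum.inl 1), 1 + b')) = Sum.inr (φ (Sum.inl 0), 2 + a') :=
      g' (Sum.inl 1, 1)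
    have v2' : σ (Sum.inr (φ (Sum.inl 1), 2 + b')) = Sum.inr (φ (Sum.inl 0), 1 + a') :=
      g' (Sum.inl 1, 2)
    have hab : ∀ a a' : Fin 4, 0 + a ≠ 1 + a' → 0 + a ≠ 2 + a' → 3 + a ≠ 1 + a' →
        3 + a ≠ 2 + a' → a = a' := by decide
    obtain rfl := hab a a' (fun h => by rw [h, u1'] at u0; cases u0)
      (fun h => by rw [h, u2'] at u0; cases u0) (fun h => by rw [h, u1'] at u3; cases u3)
      (fun h => by rw [h, u2'] at u3; cases u3)
    obtain rfl := hab b b' (fun h => by rw [h, v1'] at v0; cases v0)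
      (fun h => by rw [h, v2'] at v0; cases v0) (fun h => by rw [h, v1'] at v3; cases v3)
      (fun h => by rw [h, v2'] at v3; cases v3)
    have hs := u0.symm.trans u0'
    simpa using hs

/-! ### Values of the coefficients -/

lemma selfEnergyCoeff_zero_zero (μ N : ℝ) (Λ : ℕ) (m n : ℝ × ℝ) :
    selfEnergyCoeff μ N Λ m n 0 0 = 0 :=
  onePICoeff_zero_zero _ _ _ _ _

/-- Two of the four rotations close a color loop, so each side contributes `-(2 N + 2) / 2`. -/
lemma selfEnergyCoeff_one_zero (μ N : ℝ) (Λ : ℕ) (m n : ℝ × ℝ) :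
    selfEnergyCoeff μ N Λ m n 1 0 = -(N + 1) * (tadpoleSum μ Λ m + tadpoleSum μ Λ n) := by
  unfold selfEnergyCoeff
  rw [onePICoeff_tadpole (Equiv.refl _)]
  simp [patternAt, Fin.sum_univ_four]
  ring

lemma selfEnergyCoeff_zero_one (μ N : ℝ) (Λ : ℕ) (m n : ℝ × ℝ) :
    selfEnergyCoeff μ N Λ m n 0 1 = -(tadpoleSum μ Λ m + tadpoleSum μ Λ n) := by
  unfold selfEnergyCoeff
  rw [onePICoeff_tadpole (Equiv.sumComm _ _)]
  simp [patternAt]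
  ring

variable (μ N : ℝ) (Λ : ℕ) (e : Fin 4 → ℝ × ℝ)

lemma onePICoeff_parallel_one_zero : onePICoeff parallelMate μ N Λ e 1 0 = -1 := by
  rw [onePICoeff_star (Equiv.refl _) _ _ _ _ _ (c := 2) (by decide +kernel)]
  norm_num

lemma onePICoeff_parallel_zero_one : onePICoeff parallelMate μ N Λ e 0 1 = 0 := by
  rw [onePICoeff_star (Equiv.sumComm _ _) _ _ _ _ _ (c := 0) (by decide +kernel)]
  norm_num

lemma onePICoeff_crossed_one_zero : onePICoeff crossedMate μ N Λ e 1 0 = 0 := by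
  rw [onePICoeff_star (Equiv.refl _) _ _ _ _ _ (c := 0) (by decide +kernel)]
  norm_num

lemma onePICoeff_crossed_zero_one : onePICoeff crossedMate μ N Λ e 0 1 = -1 := by
  rw [onePICoeff_star (Equiv.sumComm _ _) _ _ _ _ _ (c := 4) (by decide +kernel)]
  norm_num

lemma onePICoeff_parallel_two_zero :
    onePICoeff parallelMate μ N Λ (fun _ => (0, 0)) 2 0 = (N + 3) * S1 μ Λ := by
  -- Both vertices of pattern `1` occur for 4 pairs of rotations; exactly one for 8; neither for 4.
  -- Each pair matches for two of the four shifts, giving 8 parameters with a loop and 16 + 8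
  -- without.
  rw [onePICoeff_bubble (Equiv.refl _) _ _ _ _ (c₁ := 8) (c₀ := 24) (by decide +kernel)
    (by decide +kernel)]
  norm_num
  ring

lemma onePICoeff_crossed_two_zero :
    onePICoeff crossedMate μ N Λ (fun _ => (0, 0)) 2 0 = 0 := by
  rw [onePICoeff_bubble (Equiv.refl _) _ _ _ _ (c₁ := 0) (c₀ := 0) (by decide +kernel)
    (by decide +kernel)]
  norm_num

lemma onePICoeff_parallel_one_one :
    onePICoeff parallelMate μ N Λ (fun _ => (0, 0)) 1 1 = 2 * S1 μ Λ := by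
  -- The first vertex of `bubble` is taken parallel and the second crossed; the shifts account for
  -- the other placement.
  rw [onePICoeff_bubble ((Equiv.sumEmpty _ _).trans (finSumFinEquiv (m := 1) (n := 1)).symm) _ _ _ _ (c₁ := 0)
    (c₀ := 16) (by decide +kernel) (by decide +kernel)]
  norm_num
  ring

lemma onePICoeff_crossed_one_one :
    onePICoeff crossedMate μ N Λ (fun _ => (0, 0)) 1 1 = 4 * S1 μ Λ := by
  rw [onePICoeff_bubble ((Equiv.sumEmpty _ _).trans (finSumFinEquiv (m := 1) (n := 1)).symm) _ _ _ _ (c₁ := 0)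
    (c₀ := 32) (by decide +kernel) (by decide +kernel)]
  norm_num
  ring

lemma onePICoeff_parallel_zero_two :
    onePICoeff parallelMate μ N Λ (fun _ => (0, 0)) 0 2 = S1 μ Λ := by
  rw [onePICoeff_bubble (Equiv.sumComm _ _) _ _ _ _ (c₁ := 0) (c₀ := 32) (by decide +kernel)
    (by decide +kernel)]
  norm_num
  ring

lemma onePICoeff_crossed_zero_two :
    onePICoeff crossedMate μ N Λ (fun _ => (0, 0)) 0 2 = 0 := by
  rw [onePICoeff_bubble (Equiv.sumComm _ _) _ _ _ _ (c₁ := 0) (c₀ := 0) (by decide +kernel)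
    (by decide +kernel)]
  norm_num

end Coefficients

/-! ### Power series up to third order -/

/-- The ideal of the power series of order at least `n`. -/
def orderIdeal (n : ℕ) : Ideal (MvPowerSeries (Fin 2) ℝ) where
  carrier := {f | (n : ℕ∞) ≤ f.order}
  add_mem' ha hb := (le_min ha hb).trans MvPowerSeries.min_order_le_add
  zero_mem' := by simp
  smul_mem' c f hf := by
    have h : (n : ℕ∞) ≤ f.order := hf
    exact (h.trans le_add_self).trans (MvPowerSeries.le_order_mul (f := c) (g := f))

lemma mem_orderIdeal {n : ℕ} {f : MvPowerSeries (Fin 2) ℝ} :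
    f ∈ orderIdeal n ↔ ∀ d : Fin 2 →₀ ℕ, d 0 + d 1 < n → MvPowerSeries.coeff d f = 0 := by
  have hdeg (d : Fin 2 →₀ ℕ) : d.degree = d 0 + d 1 := by
    rw [Finsupp.degree_eq_sum, Fin.sum_univ_two]
  constructor
  · intro h d hd
    refine MvPowerSeries.coeff_of_lt_order (lt_of_lt_of_le ?_ h)
    rw [hdeg]
    exact_mod_cast hd
  · intro h
    refine MvPowerSeries.le_order fun d hd => h d ?_
    rw [hdeg] at hd
    exact_mod_cast hd

lemma mul_mem_orderIdeal {a b : ℕ} {f g : MvPowerSeries (Fin 2) ℝ} (hf : f ∈ orderIdeal a)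
    (hg : g ∈ orderIdeal b) : f * g ∈ orderIdeal (a + b) := by
  have hf' : (a : ℕ∞) ≤ f.order := hf
  have hg' : (b : ℕ∞) ≤ g.order := hg
  have : ((a + b : ℕ) : ℕ∞) ≤ (f * g).order := by
    push_cast
    exact (add_le_add hf' hg').trans MvPowerSeries.le_order_mul
  exact this

lemma eqModCubic_iff {f g : MvPowerSeries (Fin 2) ℝ} :
    EqModCubic f g ↔ f - g ∈ orderIdeal 3 := by
  rw [mem_orderIdeal]
  refine forall_congr' fun d => ?_
  rw [Nat.lt_succ_iff, map_sub, sub_eq_zero]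

lemma coeff_C_mul_X_pow_mul_X_pow (d : Fin 2 →₀ ℕ) (c : ℝ) (a b : ℕ) :
    MvPowerSeries.coeff d (MvPowerSeries.C c * MvPowerSeries.X 0 ^ a * MvPowerSeries.X 1 ^ b) =
      if d 0 = a ∧ d 1 = b then c else 0 := by
  rw [mul_assoc, MvPowerSeries.coeff_C_mul, MvPowerSeries.X_pow_eq, MvPowerSeries.X_pow_eq,
    MvPowerSeries.monomial_mul_monomial, MvPowerSeries.coeff_monomial]
  have : d = Finsupp.single 0 a + Finsupp.single 1 b ↔ d 0 = a ∧ d 1 = b := by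
    constructor
    · rintro rfl
      simp
    · rintro ⟨rfl, rfl⟩
      ext i
      fin_cases i <;> simp
  simp [this]

/-- A polynomial of degree two without constant term. -/
def quadraticSeries (c₁₀ c₀₁ c₂₀ c₁₁ c₀₂ : ℝ) : MvPowerSeries (Fin 2) ℝ :=
  MvPowerSeries.C c₁₀ * MvPowerSeries.X 0 + MvPowerSeries.C c₀₁ * MvPowerSeries.X 1 +
    (MvPowerSeries.C c₂₀ * MvPowerSeries.X 0 ^ 2 +
      MvPowerSeries.C c₁₁ * MvPowerSeries.X 0 * MvPowerSeries.X 1 +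
      MvPowerSeries.C c₀₂ * MvPowerSeries.X 1 ^ 2)

lemma coeff_quadraticSeries (c₁₀ c₀₁ c₂₀ c₁₁ c₀₂ : ℝ) (d : Fin 2 →₀ ℕ) :
    MvPowerSeries.coeff d (quadraticSeries c₁₀ c₀₁ c₂₀ c₁₁ c₀₂) =
      (if d 0 = 1 ∧ d 1 = 0 then c₁₀ else 0) + (if d 0 = 0 ∧ d 1 = 1 then c₀₁ else 0) +
      ((if d 0 = 2 ∧ d 1 = 0 then c₂₀ else 0) + (if d 0 = 1 ∧ d 1 = 1 then c₁₁ else 0) +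
        (if d 0 = 0 ∧ d 1 = 2 then c₀₂ else 0)) := by
  simp only [← coeff_C_mul_X_pow_mul_X_pow, ← map_add]
  simp [quadraticSeries]

/-- A power series is its coefficient function, so Taylor truncation is a check of finitely many
exponents. -/
lemma sub_quadraticSeries_mem (F : ℕ → ℕ → ℝ) (h : F 0 0 = 0) :
    (show MvPowerSeries (Fin 2) ℝ from fun d => F (d 0) (d 1)) -
      quadraticSeries (F 1 0) (F 0 1) (F 2 0) (F 1 1) (F 0 2) ∈ orderIdeal 3 := by
  rw [mem_orderIdeal]
  intro d hd
  rw [map_sub, coeff_quadraticSeries]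
  change F (d 0) (d 1) - _ = 0
  generalize d 0 = a at *
  generalize d 1 = b at *
  have ha : a ≤ 2 := by omega
  have hb : b ≤ 2 := by omega
  interval_cases a <;> interval_cases b <;> first | omega | simp [h]

lemma X_mem_orderIdeal (i : Fin 2) :
    (MvPowerSeries.X i : MvPowerSeries (Fin 2) ℝ) ∈ orderIdeal 1 := by
  rw [mem_orderIdeal]
  intro d hd
  rw [MvPowerSeries.coeff_X, if_neg]
  rintro rfl
  fin_cases i <;> simp at hd

lemma orderIdeal_anti {a b : ℕ} (h : a ≤ b) : orderIdeal b ≤ orderIdeal a := fun f hf => by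
  rw [mem_orderIdeal] at *
  exact fun d hd => hf d (hd.trans_le h)

lemma quadratic_part_mem (c₂₀ c₁₁ c₀₂ : ℝ) :
    MvPowerSeries.C c₂₀ * MvPowerSeries.X 0 ^ 2 +
      MvPowerSeries.C c₁₁ * MvPowerSeries.X 0 * MvPowerSeries.X 1 +
      MvPowerSeries.C c₀₂ * MvPowerSeries.X 1 ^ 2 ∈ orderIdeal 2 := by
  have h (i j : Fin 2) := mul_mem_orderIdeal (X_mem_orderIdeal i) (X_mem_orderIdeal j)
  refine add_mem (add_mem ?_ ?_) ?_
  · rw [sq]; exact Ideal.mul_mem_left _ _ (h 0 0)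
  · rw [mul_assoc]; exact Ideal.mul_mem_left _ _ (h 0 1)
  · rw [sq]; exact Ideal.mul_mem_left _ _ (h 1 1)

lemma linear_part_mem (c₁₀ c₀₁ : ℝ) :
    MvPowerSeries.C c₁₀ * MvPowerSeries.X 0 + MvPowerSeries.C c₀₁ * MvPowerSeries.X 1 ∈
      orderIdeal 1 :=
  add_mem (Ideal.mul_mem_left _ _ (X_mem_orderIdeal 0))
    (Ideal.mul_mem_left _ _ (X_mem_orderIdeal 1))

/-- Second order expansion of `G / Z²`. -/
lemma mul_inv_sq_sub_mem {G Z P Q c : MvPowerSeries (Fin 2) ℝ} (hP : P ∈ orderIdeal 1)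
    (hQ : Q ∈ orderIdeal 2) (hc : c ∈ orderIdeal 1) (hG : G - (P + Q) ∈ orderIdeal 3)
    (hZ : Z - (1 - c) ∈ orderIdeal 2) : G * (Z ^ 2)⁻¹ - (P + Q + 2 * c * P) ∈ orderIdeal 3 := by
  set W := (Z ^ 2)⁻¹ with hW
  have hconst : ∀ f ∈ orderIdeal 1, MvPowerSeries.constantCoeff f = 0 := fun f hf =>
    mem_orderIdeal.1 hf 0 (by simp)
  have hZ0 : MvPowerSeries.constantCoeff (Z ^ 2) ≠ 0 := by
    have := hconst _ (orderIdeal_anti (by norm_num) hZ)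
    rw [map_sub, map_sub, map_one, hconst c hc] at this
    rw [map_pow, show MvPowerSeries.constantCoeff Z = 1 by linarith]
    norm_num
  have hWZ : W * Z ^ 2 = 1 := MvPowerSeries.inv_mul_cancel _ hZ0
  set z := Z - (1 - c) with hz
  have hZ' : Z = 1 - c + z := by rw [hz]; ring
  have h2 : W - 1 - 2 * c ∈ orderIdeal 2 := by
    -- From `W * Z ^ 2 = 1` and `(1 - c)² (1 + 2 c) = 1 - c² (3 - 2 c)`: the error consists of a
    -- multiple of `c * c` and a multiple of `z`.
    have : W - 1 - 2 * c =
        W * (4 - (1 + 2 * c)) * (c * c) - W * (2 * (1 - c) + z) * (1 + 2 * c) * z := by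
      have e : W - 1 - 2 * c = W - W * Z ^ 2 * (1 + 2 * c) := by rw [hWZ]; ring
      rw [e, hZ']
      ring
    rw [this]
    exact sub_mem (Ideal.mul_mem_left _ _ (mul_mem_orderIdeal hc hc)) (Ideal.mul_mem_left _ _ hZ)
  have h1 : W - 1 ∈ orderIdeal 1 := by
    have := add_mem (orderIdeal_anti (by norm_num : 1 ≤ 2) h2) (Ideal.mul_mem_left _ 2 hc)
    rwa [sub_add_cancel] at this
  have : G * W - (P + Q + 2 * c * P) =
      W * (G - (P + Q)) + P * (W - 1 - 2 * c) + Q * (W - 1) := by ring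
  rw [this]
  exact add_mem (add_mem (Ideal.mul_mem_left _ _ hG) (mul_mem_orderIdeal hP h2))
    (mul_mem_orderIdeal hQ h1)

/-! ### Renormalized couplings -/

lemma two_le_massA (μ : ℝ) : 2 ≤ massA μ := by
  unfold massA; nlinarith [sq_nonneg μ]

/-- The derivative of the propagator is minus its square, so wave function renormalization produces
the same sum as the bubble. -/
lemma hasDerivAt_tadpoleSum (μ : ℝ) (Λ : ℕ) :
    HasDerivAt (fun t : ℝ => tadpoleSum μ Λ (t, 0)) (-S1 μ Λ) 0 := by
  have h (p : Box Λ) : HasDerivAt (fun t : ℝ => propagator μ (boxPoint p) (t, 0))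
      (-(1 / (((p.1 : ℕ) : ℝ) + ((p.2 : ℕ) : ℝ) + massA μ) ^ 2)) 0 := by
    unfold propagator boxPoint
    have h1 : HasDerivAt (fun t : ℝ => ((p.1 : ℕ) : ℝ) + ((p.2 : ℕ) : ℝ) + t + 0 + massA μ) 1 0 := by
      simpa using ((hasDerivAt_id (0 : ℝ)).const_add (((p.1 : ℕ) : ℝ) + ((p.2 : ℕ) : ℝ))).add_const
        (massA μ)
    have h0 : ((p.1 : ℕ) : ℝ) + ((p.2 : ℕ) : ℝ) + 0 + 0 + massA μ ≠ 0 := by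
      have := two_le_massA μ
      positivity
    exact (h1.fun_inv h0).congr_deriv (by simp [neg_div])
  have := HasDerivAt.fun_sum fun p (_ : p ∈ Finset.univ) => h p
  rw [Finset.sum_neg_distrib] at this
  exact this

lemma dSelfEnergy_sub_mem (μ N : ℝ) (Λ : ℕ) :
    dSelfEnergy μ N Λ - (MvPowerSeries.C ((N + 1) * S1 μ Λ) * MvPowerSeries.X 0 +
      MvPowerSeries.C (S1 μ Λ) * MvPowerSeries.X 1) ∈ orderIdeal 2 := by
  set F : ℕ → ℕ → ℝ := fun a b =>
    deriv (fun t : ℝ => selfEnergyCoeff μ N Λ (t, 0) (0, 0) a b) 0 with hF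
  have h00 : F 0 0 = 0 := by simp [hF, selfEnergyCoeff_zero_zero]
  have hd := (hasDerivAt_tadpoleSum μ Λ).add_const (tadpoleSum μ Λ (0, 0))
  have h10 : F 1 0 = (N + 1) * S1 μ Λ := by
    simp only [hF, selfEnergyCoeff_one_zero]
    rw [(hd.const_mul (-(N + 1))).deriv]
    ring
  have h01 : F 0 1 = S1 μ Λ := by
    simp only [hF, selfEnergyCoeff_zero_one]
    rw [hd.fun_neg.deriv]
    ring
  have h := orderIdeal_anti (by norm_num : 2 ≤ 3) (sub_quadraticSeries_mem F h00)
  have := add_mem h (quadratic_part_mem (F 2 0) (F 1 1) (F 0 2))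
  rw [quadraticSeries, h10, h01, ← sub_sub, sub_add_cancel] at this
  exact this

/-- The `q` are the coefficients of `-Γ₄`. Dividing by `Z²` adds twice the linear part of `∂Σ` times
the linear part of `-Γ₄`. -/
lemma lambdaR_sub_mem (μ N : ℝ) (Λ : ℕ) (i : Fin 2) {q₁₀ q₀₁ q₂₀ q₁₁ q₀₂ : ℝ}
    (h₁₀ : onePICoeff (![parallelMate, crossedMate] i) μ N Λ (fun _ => (0, 0)) 1 0 = -q₁₀)
    (h₀₁ : onePICoeff (![parallelMate, crossedMate] i) μ N Λ (fun _ => (0, 0)) 0 1 = -q₀₁)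
    (h₂₀ : onePICoeff (![parallelMate, crossedMate] i) μ N Λ (fun _ => (0, 0)) 2 0 = -q₂₀)
    (h₁₁ : onePICoeff (![parallelMate, crossedMate] i) μ N Λ (fun _ => (0, 0)) 1 1 = -q₁₁)
    (h₀₂ : onePICoeff (![parallelMate, crossedMate] i) μ N Λ (fun _ => (0, 0)) 0 2 = -q₀₂) :
    EqModCubic (lambdaR μ N Λ i) (quadraticSeries q₁₀ q₀₁ (q₂₀ + 2 * (N + 1) * S1 μ Λ * q₁₀)
      (q₁₁ + 2 * (N + 1) * S1 μ Λ * q₀₁ + 2 * S1 μ Λ * q₁₀) (q₀₂ + 2 * S1 μ Λ * q₀₁)) := by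
  rw [eqModCubic_iff]
  have hG := sub_quadraticSeries_mem
    (fun a b => onePICoeff (![parallelMate, crossedMate] i) μ N Λ (fun _ => (0, 0)) a b)
    (onePICoeff_zero_zero _ _ _ _ _)
  simp only [h₁₀, h₀₁, h₂₀, h₁₁, h₀₂] at hG
  change gammaFour μ N Λ i - _ ∈ _ at hG
  have hG' : -gammaFour μ N Λ i - quadraticSeries q₁₀ q₀₁ q₂₀ q₁₁ q₀₂ ∈ orderIdeal 3 := by
    have := neg_mem hG
    convert this using 1
    simp only [quadraticSeries, map_neg]
    ring
  have hZ : waveZ μ N Λ - (1 - (MvPowerSeries.C ((N + 1) * S1 μ Λ) * MvPowerSeries.X 0 +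
      MvPowerSeries.C (S1 μ Λ) * MvPowerSeries.X 1)) ∈ orderIdeal 2 := by
    have := neg_mem (dSelfEnergy_sub_mem μ N Λ)
    convert this using 1
    unfold waveZ
    ring
  have := mul_inv_sq_sub_mem (linear_part_mem q₁₀ q₀₁) (quadratic_part_mem q₂₀ q₁₁ q₀₂)
    (linear_part_mem ((N + 1) * S1 μ Λ) (S1 μ Λ)) hG' hZ
  convert this using 1
  simp only [lambdaR, quadraticSeries, map_add, map_mul, map_ofNat, map_one]
  ring

/-- Wave function renormalization combines with the bubbles: `-(N + 3) + 2 (N + 1) = -(1 - N)`, and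
the mixed terms `-2 + 2` cancel. -/
theorem eqModCubic_lambdaR_zero (μ N : ℝ) (Λ : ℕ) : EqModCubic (lambdaR μ N Λ 0)
    (quadraticSeries 1 0 (-((1 - N) * S1 μ Λ)) 0 (-S1 μ Λ)) := by
  have := lambdaR_sub_mem μ N Λ 0 (q₁₀ := 1) (q₀₁ := 0) (q₂₀ := -((N + 3) * S1 μ Λ))
    (q₁₁ := -(2 * S1 μ Λ)) (q₀₂ := -S1 μ Λ)
    (onePICoeff_parallel_one_zero _ _ _ _)
    ((onePICoeff_parallel_zero_one _ _ _ _).trans neg_zero.symm)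
    ((onePICoeff_parallel_two_zero _ _ _).trans (neg_neg _).symm)
    ((onePICoeff_parallel_one_one _ _ _).trans (neg_neg _).symm)
    ((onePICoeff_parallel_zero_two _ _ _).trans (neg_neg _).symm)
  convert this using 2 <;> ring

theorem eqModCubic_lambdaR_one (μ N : ℝ) (Λ : ℕ) : EqModCubic (lambdaR μ N Λ 1)
    (quadraticSeries 0 1 0 (-(2 * (1 - N) * S1 μ Λ)) (2 * S1 μ Λ)) := by
  have := lambdaR_sub_mem μ N Λ 1 (q₁₀ := 0) (q₀₁ := 1) (q₂₀ := 0)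
    (q₁₁ := -(4 * S1 μ Λ)) (q₀₂ := 0)
    ((onePICoeff_crossed_one_zero _ _ _ _).trans neg_zero.symm)
    (onePICoeff_crossed_zero_one _ _ _ _)
    ((onePICoeff_crossed_two_zero _ _ _).trans neg_zero.symm)
    ((onePICoeff_crossed_one_one _ _ _).trans (neg_neg _).symm)
    ((onePICoeff_crossed_zero_two _ _ _).trans neg_zero.symm)
  convert this using 2 <;> ring

/-! ### The cut-off sum -/

lemma S1_eq_sum (μ : ℝ) (Λ : ℕ) : S1 μ Λ = ∑ p ∈ Finset.range (Λ + 1),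
    ∑ q ∈ Finset.range (Λ + 1), 1 / ((p : ℝ) + q + massA μ) ^ 2 := by
  unfold S1
  rw [Fintype.sum_prod_type, ← Fin.sum_univ_eq_sum_range
    (fun p => ∑ q ∈ Finset.range (Λ + 1), 1 / ((p : ℝ) + q + massA μ) ^ 2)]
  refine Finset.sum_congr rfl fun p _ => ?_
  rw [← Fin.sum_univ_eq_sum_range (fun q => 1 / (((p : ℕ) : ℝ) + q + massA μ) ^ 2)]

lemma S1_pos (μ : ℝ) (Λ : ℕ) : 0 < S1 μ Λ := by
  have := two_le_massA μ
  unfold S1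
  exact Finset.sum_pos (fun p _ => by positivity) Finset.univ_nonempty

lemma inv_sub_inv_add_one {x : ℝ} (hx : 0 < x) : 1 / x - 1 / (x + 1) = 1 / (x * (x + 1)) := by
  field_simp
  ring

/-- Each term is at most `1 / ((x + q - 1) (x + q))`, which telescopes; the lower bound below uses
`1 / ((x + q) (x + q + 1))`. -/
lemma sum_one_div_sq_le {x : ℝ} (hx : 1 < x) (n : ℕ) :
    ∑ q ∈ Finset.range n, 1 / (x + q) ^ 2 ≤ 1 / (x - 1) := by
  have h : ∀ n : ℕ, ∑ q ∈ Finset.range n, 1 / (x + q) ^ 2 ≤ 1 / (x - 1) - 1 / (x - 1 + n) := by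
    intro n
    induction n with
    | zero => simp
    | succ n ih =>
      rw [Finset.sum_range_succ]
      have h0 : 0 < x - 1 + n := by
        have : (0 : ℝ) ≤ n := by positivity
        linarith
      have h1 := inv_sub_inv_add_one h0
      have h2 : 1 / (x + n) ^ 2 ≤ 1 / ((x - 1 + n) * (x - 1 + n + 1)) :=
        one_div_le_one_div_of_le (by positivity) (by nlinarith)
      push_cast
      rw [← add_assoc]
      linarith
  refine (h n).trans ?_
  have : 0 ≤ 1 / (x - 1 + n) := by
    have : (0 : ℝ) ≤ n := by positivity
    have : 0 < x - 1 + n := by linarith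
    positivity
  linarith

lemma le_sum_one_div_sq {x : ℝ} (hx : 0 < x) (n : ℕ) :
    1 / x - 1 / (x + n) ≤ ∑ q ∈ Finset.range n, 1 / (x + q) ^ 2 := by
  induction n with
  | zero => simp
  | succ n ih =>
    rw [Finset.sum_range_succ]
    have h0 : 0 < x + n := by positivity
    have h1 := inv_sub_inv_add_one h0
    have h2 : 1 / ((x + n) * (x + n + 1)) ≤ 1 / (x + n) ^ 2 :=
      one_div_le_one_div_of_le (by positivity) (by nlinarith)
    push_cast
    rw [← add_assoc]
    linarith

lemma log_add_one_sub_log_le {x : ℝ} (hx : 0 < x) : Real.log (x + 1) - Real.log x ≤ 1 / x := by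
  rw [← Real.log_div (by positivity) hx.ne']
  refine (Real.log_le_sub_one_of_pos (by positivity)).trans (le_of_eq ?_)
  field_simp
  ring

/-- As `massA μ ≥ 2`, the inner sums are at most `1 / (p + 1)`. The constant `2` is one from the
harmonic sum and one from replacing `log (Λ + 1)` by `log Λ`. -/
lemma S1_le (μ : ℝ) {Λ : ℕ} (hΛ : 1 ≤ Λ) : S1 μ Λ ≤ Real.log Λ + 2 := by
  have hA := two_le_massA μ
  have h1 : S1 μ Λ ≤ ∑ p ∈ Finset.range (Λ + 1), 1 / ((p : ℝ) + 1) := by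
    rw [S1_eq_sum]
    refine Finset.sum_le_sum fun p _ => ?_
    have hp : (0 : ℝ) ≤ p := by positivity
    have := sum_one_div_sq_le (x := p + massA μ) (by linarith) (Λ + 1)
    simp only [add_right_comm (p : ℝ) _ (massA μ)]
    exact this.trans (one_div_le_one_div_of_le (by positivity) (by linarith))
  have h2 : ∑ p ∈ Finset.range (Λ + 1), 1 / ((p : ℝ) + 1) ≤ 1 + Real.log (Λ + 1) := by
    have := harmonic_le_one_add_log (Λ + 1)
    simpa [harmonic] using this
  have hΛ' : (1 : ℝ) ≤ Λ := by exact_mod_cast hΛ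
  have h3 := log_add_one_sub_log_le (x := Λ) (by positivity)
  have h4 : 1 / (Λ : ℝ) ≤ 1 := by
    rw [div_le_one (by positivity)]
    exact hΛ'
  linarith

lemma le_S1 (μ : ℝ) {Λ : ℕ} (hΛ : 1 ≤ Λ) :
    Real.log Λ - Real.log (massA μ) - 1 ≤ S1 μ Λ := by
  have hA := two_le_massA μ
  -- The upper ends of the telescoping sums cost at most `1 / (Λ + 1)` for each of the `Λ + 1`
  -- values of `p`, hence `1` in total.
  have h1 : ∑ p ∈ Finset.range (Λ + 1), (1 / ((p : ℝ) + massA μ) - 1 / ((Λ : ℝ) + 1)) ≤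
      S1 μ Λ := by
    rw [S1_eq_sum]
    refine Finset.sum_le_sum fun p _ => ?_
    have hp : (0 : ℝ) ≤ p := by positivity
    have h := le_sum_one_div_sq (x := p + massA μ) (by positivity) (Λ + 1)
    simp only [add_right_comm (p : ℝ) _ (massA μ)]
    refine le_trans ?_ h
    refine sub_le_sub_left (one_div_le_one_div_of_le (by positivity) ?_) _
    push_cast
    linarith
  rw [Finset.sum_sub_distrib, Finset.sum_const, Finset.card_range, nsmul_eq_mul] at h1
  have h2 : ∀ n : ℕ, Real.log (n + massA μ) - Real.log (massA μ) ≤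
      ∑ p ∈ Finset.range n, 1 / ((p : ℝ) + massA μ) := by
    intro n
    induction n with
    | zero => simp
    | succ n ih =>
      rw [Finset.sum_range_succ]
      have := log_add_one_sub_log_le (x := n + massA μ) (by positivity)
      push_cast
      rw [add_right_comm (n : ℝ) 1]
      linarith
  have h3 := h2 (Λ + 1)
  have hΛ' : (1 : ℝ) ≤ Λ := by exact_mod_cast hΛ
  have h4 : Real.log Λ ≤ Real.log ((Λ + 1 : ℕ) + massA μ) :=
    Real.log_le_log (by positivity) (by push_cast; linarith)
  have h5 : ((Λ + 1 : ℕ) : ℝ) * (1 / ((Λ : ℝ) + 1)) = 1 := by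
    push_cast
    field_simp
  linarith

theorem S1_sub_log_isBigO (μ : ℝ) :
    (fun Λ : ℕ => S1 μ Λ - Real.log (Λ : ℝ)) =O[atTop] (fun _ => (1 : ℝ)) := by
  refine IsBigO.of_bound (2 + |Real.log (massA μ)|) ?_
  filter_upwards [eventually_ge_atTop 1] with Λ hΛ
  have h1 := S1_le μ hΛ
  have h2 := le_S1 μ hΛ
  have h3 := le_abs_self (Real.log (massA μ))
  have h4 := abs_nonneg (Real.log (massA μ))
  rw [norm_one, mul_one, Real.norm_eq_abs, abs_le]
  constructor <;> linarith

theorem tendsto_S1 (μ : ℝ) : Tendsto (fun Λ : ℕ => S1 μ Λ) atTop atTop := by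
  have h : Tendsto (fun Λ : ℕ => Real.log (Λ : ℝ) + (-Real.log (massA μ) - 1)) atTop atTop :=
    tendsto_atTop_add_const_right _ _ (Real.tendsto_log_atTop.comp tendsto_natCast_atTop_atTop)
  refine tendsto_atTop_mono' _ ?_ h
  filter_upwards [eventually_ge_atTop 1] with Λ hΛ
  have := le_S1 μ hΛ
  linarith

/-! ### β-functions and flow -/

lemma flowCoeff_of_eqModCubic {μ N : ℝ} {Λ : ℕ} {i : Fin 2} {f : MvPowerSeries (Fin 2) ℝ}
    (h : EqModCubic (lambdaR μ N Λ i) f) {a b : ℕ} (hab : a + b ≤ 2) :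
    flowCoeff μ N Λ i a b =
      -MvPowerSeries.coeff (Finsupp.single 0 a + Finsupp.single 1 b) f / S1 μ Λ := by
  unfold flowCoeff
  rw [h _ (by simpa using hab)]

lemma betaParallel_eq (μ N : ℝ) (Λ : ℕ) : betaParallel μ N Λ = 1 - N := by
  unfold betaParallel
  rw [flowCoeff_of_eqModCubic (eqModCubic_lambdaR_zero μ N Λ) (by norm_num), coeff_quadraticSeries]
  have := (S1_pos μ Λ).ne'
  simp
  field_simp

lemma betaCrossed_eq (μ N : ℝ) (Λ : ℕ) : betaCrossed μ N Λ = -2 := by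
  unfold betaCrossed
  rw [flowCoeff_of_eqModCubic (eqModCubic_lambdaR_one μ N Λ) (by norm_num), coeff_quadraticSeries]
  have := (S1_pos μ Λ).ne'
  simp
  field_simp

/-- The line is invariant because `λ_{2,r}` has no `λ₁²` term. -/
lemma betaFunction_parallel (μ N : ℝ) (Λ : ℕ) (x : ℝ) :
    betaFunction μ N Λ ![x, 0] = ![(1 - N) * x ^ 2, 0] := by
  have h1 : flowCoeff μ N Λ 0 2 0 = 1 - N := betaParallel_eq μ N Λ
  have h2 : flowCoeff μ N Λ 1 2 0 = 0 := by
    rw [flowCoeff_of_eqModCubic (eqModCubic_lambdaR_one μ N Λ) (by norm_num),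
      coeff_quadraticSeries]
    simp
  funext i
  fin_cases i
  · simp [betaFunction, h1]
  · simp [betaFunction, h2]

lemma isParallelFlow_iff {β : (Fin 2 → ℝ) → Fin 2 → ℝ} {κ : ℝ}
    (hβ : ∀ x, β ![x, 0] = ![κ * x ^ 2, 0]) {g : ℝ} {I : Set ℝ} {x : ℝ → ℝ} :
    IsParallelFlow β g I x ↔ x 0 = g ∧ ∀ s ∈ I, HasDerivWithinAt x (κ * x s ^ 2) I s := by
  unfold IsParallelFlow
  refine and_congr_right fun _ => forall₂_congr fun s _ => ?_
  rw [hβ, hasDerivWithinAt_pi, Fin.forall_fin_two]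
  simp [hasDerivWithinAt_const]

/-- Solutions of `x' = κ x²`. -/
lemma mul_eq_of_quadratic_flow {κ g b : ℝ} {x : ℝ → ℝ} (hb : 0 ≤ b) (h0 : x 0 = g)
    (hx : ∀ s ∈ Set.Icc 0 b, HasDerivWithinAt x (κ * x s ^ 2) (Set.Icc 0 b) s) :
    x b * (1 - κ * g * b) = g := by
  have hcont : ContinuousOn x (Set.Icc 0 b) := fun s hs => (hx s hs).continuousWithinAt
  obtain ⟨K, hK⟩ := isCompact_Icc.exists_bound_of_continuousOn (hcont.const_smul κ)
  have hlin (s : ℝ) : HasDerivAt (fun s => 1 - κ * g * s) (-(κ * g)) s := by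
    simpa using ((hasDerivAt_id s).const_mul (κ * g)).const_sub 1
  -- The defect `y = x (1 - κ g s) - g` solves the linear equation `y' = κ x y` with `y 0 = 0`, and
  -- `κ x` is bounded on the compact interval, so uniqueness gives `y = 0`. Working without division
  -- avoids assuming that the denominator does not vanish.
  have hy (s : ℝ) (hs : s ∈ Set.Icc 0 b) : HasDerivWithinAt (fun s => x s * (1 - κ * g * s) - g)
      (κ * x s * (x s * (1 - κ * g * s) - g)) (Set.Icc 0 b) s :=
    (((hx s hs).mul (hlin s).hasDerivWithinAt).sub_const g).congr_deriv (by ring)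
  have hmono {s : ℝ} {f : ℝ → ℝ} {f' : ℝ} (hs : s ∈ Set.Ico 0 b)
      (h : HasDerivWithinAt f f' (Set.Icc 0 b) s) : HasDerivWithinAt f f' (Set.Ici s) s := by
    refine h.mono_of_mem_nhdsWithin (mem_of_superset (Icc_mem_nhdsGE hs.2) ?_)
    exact Set.Icc_subset_Icc_left hs.1
  have key := ODE_solution_unique_of_mem_Icc_right (v := fun s y => κ * x s * y)
    (s := fun _ => Set.univ) (K := K.toNNReal)
    (f := fun s => x s * (1 - κ * g * s) - g) (g := fun _ => 0) (a := 0) (b := b)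
    (fun s hs => LipschitzWith.lipschitzOnWith (LipschitzWith.of_dist_le_mul fun y z => by
      rw [Real.dist_eq, Real.dist_eq, ← mul_sub, abs_mul]
      refine mul_le_mul_of_nonneg_right ?_ (abs_nonneg _)
      exact (hK s ⟨hs.1, hs.2.le⟩).trans (Real.le_coe_toNNReal K)))
    (fun s hs => (hy s hs).continuousWithinAt) (fun s hs => hmono hs (hy s ⟨hs.1, hs.2.le⟩))
    (fun _ _ => Set.mem_univ _) continuousOn_const
    (fun s _ => by simpa using hasDerivWithinAt_const s (Set.Ici s) (0 : ℝ))
    (fun _ _ => Set.mem_univ _) (by simp [h0])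
  have := key ⟨hb, le_rfl⟩
  simpa [sub_eq_zero] using this

lemma hasDerivAt_quadratic_flow {κ g s : ℝ} (h : 1 - κ * g * s ≠ 0) :
    HasDerivAt (fun s => g / (1 - κ * g * s)) (κ * (g / (1 - κ * g * s)) ^ 2) s := by
  have hlin : HasDerivAt (fun s => 1 - κ * g * s) (-(κ * g)) s := by
    simpa using ((hasDerivAt_id s).const_mul (κ * g)).const_sub 1
  refine ((hasDerivAt_const s g).fun_div hlin h).congr_deriv ?_
  field_simp
  ring

theorem asymptoticallyFree_of_neg {β : (Fin 2 → ℝ) → Fin 2 → ℝ} {κ : ℝ} (hκ : κ < 0)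
    (hβ : ∀ x, β ![x, 0] = ![κ * x ^ 2, 0]) : AsymptoticallyFree β := by
  intro g hg
  have hD {s : ℝ} (hs : 0 ≤ s) : 0 < 1 - κ * g * s := by
    have : 0 ≤ -κ * g * s := mul_nonneg (mul_nonneg (by linarith) hg.le) hs
    linarith
  constructor
  · refine ⟨fun s => g / (1 - κ * g * s), (isParallelFlow_iff hβ).2 ⟨by simp, fun s hs => ?_⟩⟩
    exact (hasDerivAt_quadratic_flow (hD hs).ne').hasDerivWithinAt
  · intro x hx
    obtain ⟨h0, hx⟩ := (isParallelFlow_iff hβ).1 hx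
    have hlim : Tendsto (fun s => g / (1 - κ * g * s)) atTop (𝓝 0) := by
      refine Tendsto.const_div_atTop ?_ g
      have h : Tendsto (fun s : ℝ => 1 + (-κ * g) * s) atTop atTop :=
        tendsto_atTop_add_const_left _ _
          (tendsto_id.const_mul_atTop (mul_pos (by linarith) hg))
      refine h.congr fun s => ?_
      ring
    refine hlim.congr' ?_
    filter_upwards [eventually_ge_atTop 0] with s hs
    rw [div_eq_iff (hD hs).ne']
    exact (mul_eq_of_quadratic_flow hs h0 fun t ht =>
      (hx t ht.1).mono Set.Icc_subset_Ici_self).symm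

theorem hasLandauGhost_of_pos {β : (Fin 2 → ℝ) → Fin 2 → ℝ} {κ : ℝ} (hκ : 0 < κ)
    (hβ : ∀ x, β ![x, 0] = ![κ * x ^ 2, 0]) : HasLandauGhost β := by
  intro g hg
  have hκg : 0 < κ * g := mul_pos hκ hg
  have hD {s : ℝ} (hs : s < (κ * g)⁻¹) : 0 < 1 - κ * g * s := by
    have := mul_lt_mul_of_pos_left hs hκg
    rw [mul_inv_cancel₀ hκg.ne'] at this
    linarith
  -- The ghost scale is the zero of the denominator `1 - κ g s`.
  refine ⟨(κ * g)⁻¹, inv_pos.2 hκg, ?_, ?_⟩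
  · refine ⟨fun s => g / (1 - κ * g * s), (isParallelFlow_iff hβ).2 ⟨by simp, fun s hs => ?_⟩⟩
    exact (hasDerivAt_quadratic_flow (hD hs.2).ne').hasDerivWithinAt
  · intro x hx
    obtain ⟨h0, hx⟩ := (isParallelFlow_iff hβ).1 hx
    have hlim : Tendsto (fun s => g / (1 - κ * g * s)) (𝓝[<] (κ * g)⁻¹) atTop := by
      simp only [div_eq_mul_inv]
      refine Tendsto.const_mul_atTop hg (tendsto_inv_nhdsGT_zero.comp ?_)
      refine tendsto_nhdsWithin_iff.2 ⟨?_, ?_⟩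
      · have h : Continuous fun s : ℝ => 1 - κ * g * s := by fun_prop
        have := h.tendsto (κ * g)⁻¹
        rw [mul_inv_cancel₀ hκg.ne', sub_self] at this
        exact this.mono_left nhdsWithin_le_nhds
      · filter_upwards [self_mem_nhdsWithin] with s hs using hD hs
    refine hlim.congr' ?_
    filter_upwards [self_mem_nhdsWithin, Ioo_mem_nhdsLT (inv_pos.2 hκg)] with s hs hs'
    rw [div_eq_iff (hD hs).ne']
    exact (mul_eq_of_quadratic_flow hs'.1.le h0 fun t ht =>
      (hx t ⟨ht.1, ht.2.trans_lt hs⟩).mono fun u hu => ⟨hu.1, hu.2.trans_lt hs⟩).symm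

end ColorGW

end

/-! ### Assembly of the theorem -/

theorem theorem1 (μ N : ℝ) :
    (∀ Λ : ℕ,
      ColorGW.EqModCubic (ColorGW.lambdaR μ N Λ 0)
        (MvPowerSeries.X 0 -
          (MvPowerSeries.C (1 - N) * MvPowerSeries.X 0 ^ 2 + MvPowerSeries.X 1 ^ 2) *
            MvPowerSeries.C (ColorGW.S1 μ Λ)) ∧
      ColorGW.EqModCubic (ColorGW.lambdaR μ N Λ 1)
        (MvPowerSeries.X 1 +
          (2 * MvPowerSeries.X 1 ^ 2 -
              2 * MvPowerSeries.C (1 - N) * MvPowerSeries.X 0 * MvPowerSeries.X 1) *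
            MvPowerSeries.C (ColorGW.S1 μ Λ)) ∧
      ColorGW.betaParallel μ N Λ = 1 - N ∧
      ColorGW.betaCrossed μ N Λ = -2 ∧
      (1 < N → ColorGW.AsymptoticallyFree (ColorGW.betaFunction μ N Λ)) ∧
      (N < 1 → ColorGW.HasLandauGhost (ColorGW.betaFunction μ N Λ)) ∧
      ((∀ x : ℝ, ColorGW.betaFunction μ N Λ ![x, 0] = 0) ↔ N = 1)) ∧
    Tendsto (fun Λ : ℕ => ColorGW.S1 μ Λ) atTop atTop ∧
    (fun Λ : ℕ => ColorGW.S1 μ Λ - Real.log (Λ : ℝ)) =O[atTop] (fun _ => (1 : ℝ)) := by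
  refine ⟨fun Λ => ⟨?_, ?_, ColorGW.betaParallel_eq μ N Λ, ColorGW.betaCrossed_eq μ N Λ,
    fun h => ColorGW.asymptoticallyFree_of_neg (sub_neg.2 h) (ColorGW.betaFunction_parallel μ N Λ),
    fun h => ColorGW.hasLandauGhost_of_pos (sub_pos.2 h) (ColorGW.betaFunction_parallel μ N Λ),
    ?_⟩, ColorGW.tendsto_S1 μ, ColorGW.S1_sub_log_isBigO μ⟩
  · convert ColorGW.eqModCubic_lambdaR_zero μ N Λ using 1
    simp only [ColorGW.quadraticSeries, map_neg, map_mul, map_sub, map_one, map_zero]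
    ring
  · convert ColorGW.eqModCubic_lambdaR_one μ N Λ using 1
    simp only [ColorGW.quadraticSeries, map_neg, map_mul, map_sub, map_one, map_zero, map_ofNat]
    ring
  · simp only [ColorGW.betaFunction_parallel]
    constructor
    · intro h
      have := congrFun (h 1) 0
      simp at this
      linarith
    · rintro rfl x
      funext i
      fin_cases i <;> simp
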